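/- A signed graph $\Gamma=(G,\sigma)$ is a finite simple graph $G$ together with a map $\sigma:E(G)\to\{-1,1\}$; its adjacency matrix has $(u,v)$-entry $\sigma(uv)$ if $uv\in E(G)$ and $0$ otherwise, and its spectral radius $\rho(\Gamma)$ is the largest absolute value of an eigenvalue of this matrix. A cycle of $\Gamma$ is negative if it has an odd number of negative edges, and $\Gamma$ is unbalanced if it contains a negative cycle. Switching in a vertex subset $U$ reverses the signs of all edges with exactly one end in $U$; two signed graphs are switching equivalent if one can be obtained from the other by switching in some $U$, and switching isomorphic if one is isomorphic to a signed graph that is switching equivalent to the other. For integers $3\le r\le s$, let $\Gamma_{r,s}$ be the signed bipartite graph obtained from the all-positive complete bipartite graph $K_{r-1,s-1}$ by deleting an edge $uv$ and adding a path of length three (with two new internal vertices) connecting $u$ and $v$, whose central edge is the only negative edge. Theorem. Let $\Gamma$ be an unbalanced signed bipartite graph of order $n\ge 6$ containing no negative cycle of length $4$. Then \[ \rho(\Gamma)\le \begin{cases} \frac{1}{4}\left(n-6+\sqrt{(n-2)(n+6)}\right) & \text{if } n \text{ is even},\\ \sqrt{\frac{1}{8}\left(n^2-4n+11+\sqrt{(n^2-4n+11)^2-64(n-2)(n-4)}\right)}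 & \text{if } n \text{ is odd}, \end{cases} \] and equality holds if and only if $\Gamma$ is switching isomorphic to $\Gamma_{\lfloor n/2\rfloor,\lceil n/2\rceil}$. -/

import Mathlib

/-- A signed graph on the vertex set `V`: a simple graph together with a signature, which assigns
one of the signs `1`, `-1` (the elements of `ℤˣ`) to each edge. -/
structure SignedGraph (V : Type*) where
  /-- the underlying graph -/
  graph : SimpleGraph V
  /-- the signature -/
  sign : graph.edgeSet → ℤˣ

namespace SignedGraph

/-- The pair `e` is a negative edge of `Γ`. -/
def IsNegEdge {V : Type*} (Γ : SignedGraph V) (e : Sym2 V) : Prop :=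
  ∃ h : e ∈ Γ.graph.edgeSet, Γ.sign ⟨e, h⟩ = -1

open Classical in
/-- The adjacency matrix: the `(u, v)` entry is the sign of the edge `uv`, or `0` when `u` and `v`
are not adjacent. -/
noncomputable def adjMatrix {V : Type*} (Γ : SignedGraph V) : Matrix V V ℝ :=
  Matrix.of fun u v => if h : Γ.graph.Adj u v then (((Γ.sign ⟨s(u, v), h⟩ : ℤˣ) : ℤ) : ℝ) else 0

/-- The spectral radius: the largest absolute value of an eigenvalue of the adjacency matrix.
(The matrix is real symmetric, so all its eigenvalues are real.) -/
noncomputable def rho {V : Type*} [Fintype V] [DecidableEq V] (Γ : SignedGraph V) : ℝ :=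
  (spectralRadius ℝ Γ.adjMatrix).toReal

open Classical in
/-- A closed walk is a negative cycle if it is a cycle with an odd number of negative edges. -/
def IsNegCycle {V : Type*} (Γ : SignedGraph V) {v : V} (w : Γ.graph.Walk v v) : Prop :=
  w.IsCycle ∧ Odd (w.edges.countP fun e => Γ.IsNegEdge e)

/-- A signed graph is unbalanced if it contains a negative cycle. -/
def Unbalanced {V : Type*} (Γ : SignedGraph V) : Prop :=
  ∃ (v : V) (w : Γ.graph.Walk v v), Γ.IsNegCycle w

/-- `Γ` contains a negative cycle of length `m`. -/
def HasNegCycleOfLength {V : Type*} (Γ : SignedGraph V) (m : ℕ) : Prop :=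
  ∃ (v : V) (w : Γ.graph.Walk v v), Γ.IsNegCycle w ∧ w.length = m

open Classical in
/-- Switching in `U`: reverse the signs of the edges with one end in `U` and the other outside. -/
noncomputable def switch {V : Type*} (Γ : SignedGraph V) (U : Set V) : SignedGraph V where
  graph := Γ.graph
  sign e := if ∃ u ∈ U, ∃ v ∉ U, (e : Sym2 V) = s(u, v) then -Γ.sign e else Γ.sign e

/-- Signed graphs are switching equivalent if one is obtained from the other by switching. -/
def SwitchingEquivalent {V : Type*} (Γ Γ' : SignedGraph V) : Prop :=
  ∃ U : Set V, Γ' = Γ.switch U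

/-- Signed graphs are isomorphic if there is a sign-preserving isomorphism of the underlying
graphs. -/
def Isomorphic {V W : Type*} (Γ : SignedGraph V) (Δ : SignedGraph W) : Prop :=
  ∃ φ : Γ.graph ≃g Δ.graph, ∀ e : Γ.graph.edgeSet, Δ.sign (φ.mapEdgeSet e) = Γ.sign e

/-- Signed graphs are switching isomorphic if one is isomorphic to a signed graph that is
switching equivalent to the other. -/
def SwitchingIsomorphic {V W : Type*} (Γ : SignedGraph V) (Δ : SignedGraph W) : Prop :=
  ∃ Δ' : SignedGraph W, Δ.SwitchingEquivalent Δ' ∧ Γ.Isomorphic Δ'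

/-- Adjacency between the two sides `Fin r` and `Fin s` of the extremal graph. The vertices
`i ≥ 1` and `j ≥ 1` carry a complete bipartite graph with `r - 1` and `s - 1` vertices, from which
the edge between `u = (i = 1)` and `v = (j = 1)` is deleted; the new vertices `u₁ = (i = 0)` and
`v₁ = (j = 0)` form the path `u v₁ u₁ v`. -/
def extremalRel {r s : ℕ} (i : Fin r) (j : Fin s) : Prop :=
  (1 ≤ i.val ∧ 1 ≤ j.val ∧ ¬(i.val = 1 ∧ j.val = 1)) ∨
    (i.val = 1 ∧ j.val = 0) ∨ (i.val = 0 ∧ j.val = 0) ∨ (i.val = 0 ∧ j.val = 1)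

/-- The underlying graph of the extremal signed graph (meant for `r, s ≥ 3`). -/
def extremalGraph (r s : ℕ) : SimpleGraph (Fin r ⊕ Fin s) where
  Adj
    | .inl i, .inr j => extremalRel i j
    | .inr j, .inl i => extremalRel i j
    | _, _ => False
  symm := ⟨by rintro (i | j) (i' | j') h <;> exact h⟩
  loopless := ⟨by rintro (i | j) h <;> exact h⟩

open Classical in
/-- The signed graph obtained from the all-positive complete bipartite graph with parts of
`r - 1` and `s - 1` vertices by deleting an edge `uv` and adding a path `u v₁ u₁ v` of length
three whose central edge `u₁v₁` is the only negative edge (meant for `r, s ≥ 3`). -/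
noncomputable def extremal (r s : ℕ) : SignedGraph (Fin r ⊕ Fin s) where
  graph := extremalGraph r s
  sign e :=
    if ∃ (i : Fin r) (j : Fin s), i.val = 0 ∧ j.val = 0 ∧
      (e : Sym2 (Fin r ⊕ Fin s)) = s(.inl i, .inr j) then -1 else 1

end SignedGraph

/-! Take an eigenvector for an eigenvalue of modulus `Γ.rho`. Bipartiteness makes the eigenvalue
nonnegative, and the zero case is trivial; switching makes the eigenvector nonnegative. Among all
such switchings take one with fewest negative edges. Unbalance leaves a negative edge `uv`, and
minimality gives each of its ends a positive edge (`exists_switching`).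

Let `M` be the switched biadjacency matrix and `(ξ, η)` the resulting nonnegative singular pair with
singular value `μ`. As no 4-cycle is negative, a positive neighbour of `u` and one of `v` are never
joined by a positive edge. Hence `⟪ξ, M η⟫` is at most the form of the complete bipartite graph off
`u`, `v`, minus a product `s * t` with `s ≥ μ * η v` and `t ≥ μ * ξ u` (`sum_le_of_entry`). Either
`s * t` dominates `(ξ z - ξ u) * (η w - η v)` for some positive neighbours `z` of `v` and `w` of
`u`, so that the form is bounded by that of the extremal block `pathBlock u z v w`, or `μ ^ 2` is at
most `(|X| - 2) * (|Y| - 2)`, which is too small (`exists_pathBlock_ge`).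

The extremal block has rank at most two, so its norm is governed by a binary quadratic form whose
discriminant is `extPoly`. For fixed order and `l > 4`, `extPoly a b l` decreases in `a * b`, so
balanced parts are the unique optimum (`rhoBound_conditions`). In case of equality `M` and the block
share their singular pair, which forces `M` to be the block (`eq_pathBlock`).

For `n = 6` the squared bound is `3`, so the condition `l > 4` fails. There a negative cycle must be
a spanning hexagon without chords, and that is already the extremal graph
(`switchingIsomorphic_of_card_six`). -/

namespace SignedGraph

open Finset

/-! ### The extremal block and its operator norm -/

section Block

variable {X Y : Type*} [DecidableEq X] [DecidableEq Y]

/-- The indicator function of the complement of `u`. -/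
def offInd (u i : X) : ℝ := if i = u then 0 else 1

/-- The indicator function of `z` minus the indicator function of `u`. -/
def diffInd (z u i : X) : ℝ := (if i = z then 1 else 0) - (if i = u then 1 else 0)

/-- The biadjacency matrix of the signed graph obtained from a complete bipartite graph on
`X \ {u}` and `Y \ {v}` by deleting the edge `zw` and adding the path `z v u w` with negative
central edge. -/
def pathBlock (u z : X) (v w : Y) (i : X) (j : Y) : ℝ :=
  offInd u i * offInd v j - diffInd z u i * diffInd w v j

theorem offInd_self (u : X) : offInd u u = 0 := if_pos rfl

theorem offInd_of_ne {u i : X} (h : i ≠ u) : offInd u i = 1 := if_neg h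

theorem offInd_nonneg (u i : X) : 0 ≤ offInd u i := by unfold offInd; split_ifs <;> norm_num

theorem diffInd_left {z u : X} (h : z ≠ u) : diffInd z u z = 1 := by simp [diffInd, h]

theorem diffInd_right {z u : X} (h : u ≠ z) : diffInd z u u = -1 := by simp [diffInd, h]

theorem diffInd_of_ne {z u i : X} (h : i ≠ z) (h' : i ≠ u) : diffInd z u i = 0 := by
  simp [diffInd, h, h']

theorem pathBlock_swap (u z : X) (v w : Y) (i : X) (j : Y) :
    pathBlock v w u z j i = pathBlock u z v w i j := by
  unfold pathBlock; ring

variable [Fintype X]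

theorem sum_offInd_mul (u : X) (ξ : X → ℝ) : ∑ i, offInd u i * ξ i = ∑ i, ξ i - ξ u := by
  have : ∀ i, offInd u i * ξ i = ξ i - if i = u then ξ i else 0 := by
    intro i; unfold offInd; split_ifs <;> ring
  simp [this, sum_sub_distrib]

theorem sum_diffInd_mul (z u : X) (ξ : X → ℝ) : ∑ i, diffInd z u i * ξ i = ξ z - ξ u := by
  simp [diffInd, sub_mul, sum_sub_distrib]

theorem sum_offInd_sq (u : X) : ∑ i, offInd u i ^ 2 = (Fintype.card X : ℝ) - 1 := by
  have h := sum_offInd_mul u (offInd u)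
  have h1 := sum_offInd_mul u (fun _ => (1 : ℝ))
  simp only [mul_one, sum_const, card_univ, nsmul_eq_mul] at h1
  simp only [pow_two, h, h1]
  simp [offInd]

theorem sum_offInd_mul_diffInd {z u : X} (h : u ≠ z) : ∑ i, offInd u i * diffInd z u i = 1 := by
  rw [sum_offInd_mul]
  simp [diffInd, sum_sub_distrib, h]

theorem sum_diffInd_sq {z u : X} (h : u ≠ z) : ∑ i, diffInd z u i ^ 2 = 2 := by
  simp only [pow_two, sum_diffInd_mul]
  simp [diffInd, h, h.symm]
  norm_num

theorem sum_pathBlock_mul (u z : X) (v w : Y) (ξ : X → ℝ) (j : Y) :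
    ∑ i, pathBlock u z v w i j * ξ i =
      offInd v j * (∑ i, offInd u i * ξ i) - diffInd w v j * ∑ i, diffInd z u i * ξ i := by
  simp only [pathBlock, mul_sum, ← sum_sub_distrib]
  exact sum_congr rfl fun i _ => by ring

variable [Fintype Y]

theorem sum_sum_pathBlock (u z : X) (v w : Y) (ξ : X → ℝ) (η : Y → ℝ) :
    ∑ i, ∑ j, pathBlock u z v w i j * ξ i * η j =
      (∑ i, offInd u i * ξ i) * (∑ j, offInd v j * η j) - (ξ z - ξ u) * (η w - η v) := by
  rw [sum_comm, ← sum_diffInd_mul z u ξ, ← sum_diffInd_mul w v η, mul_sum, mul_sum,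
    ← sum_sub_distrib]
  refine sum_congr rfl fun j _ => ?_
  rw [← sum_mul, sum_pathBlock_mul]
  ring

theorem sum_sq_pathBlock (u z : X) {v w : Y} (hvw : v ≠ w) (ξ : X → ℝ) {S D : ℝ}
    (hS : S = ∑ i, offInd u i * ξ i) (hD : D = ξ z - ξ u) :
    ∑ j, (∑ i, pathBlock u z v w i j * ξ i) ^ 2 =
      ((Fintype.card Y : ℝ) - 1) * S ^ 2 - 2 * S * D + 2 * D ^ 2 := by
  simp only [sum_pathBlock_mul, sum_diffInd_mul, ← hS, ← hD]
  have h1 : 2 * S * D = ∑ j, 2 * S * D * (offInd v j * diffInd w v j) := by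
    rw [← mul_sum, sum_offInd_mul_diffInd hvw, mul_one]
  have h2 : 2 * D ^ 2 = ∑ j, diffInd w v j ^ 2 * D ^ 2 := by
    rw [← sum_mul, sum_diffInd_sq hvw]
  rw [h1, h2, ← sum_offInd_sq v, sum_mul, ← sum_sub_distrib, ← sum_add_distrib]
  exact sum_congr rfl fun j _ => by ring

/-- Bessel's inequality for the plane spanned by `offInd u` and `diffInd z u`. Their Gram matrix is
`[[a - 1, 1], [1, 2]]`, of determinant `2 * a - 3`; the left side is the adjugate form at `(S, D)`.
-/
theorem gram_le {u z : X} (huz : u ≠ z) (ξ : X → ℝ) {S D : ℝ}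
    (hS : S = ∑ i, offInd u i * ξ i) (hD : D = ξ z - ξ u) :
    2 * S ^ 2 - 2 * S * D + ((Fintype.card X : ℝ) - 1) * D ^ 2 ≤
      (2 * (Fintype.card X : ℝ) - 3) * ∑ i, ξ i ^ 2 := by
  have ha : (2 : ℝ) ≤ Fintype.card X := by
    have : 1 < Fintype.card X := Fintype.one_lt_card_iff.2 ⟨u, z, huz⟩
    exact_mod_cast this
  set a : ℝ := (Fintype.card X : ℝ) with hadef
  rw [← sum_diffInd_mul z u ξ] at hD
  -- This is `2 * a - 3` times the difference of `ξ` and its orthogonal projection to the plane.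
  have key : 0 ≤ ∑ i, ((2 * a - 3) * ξ i - ((2 * S - D) * offInd u i +
      ((a - 1) * D - S) * diffInd z u i)) ^ 2 := sum_nonneg fun i _ => sq_nonneg _
  have expand : ∀ k x y : ℝ, ∑ i, (k * ξ i - (x * offInd u i + y * diffInd z u i)) ^ 2 =
      k ^ 2 * ∑ i, ξ i ^ 2 - 2 * k * (x * S + y * D) + x ^ 2 * ∑ i, offInd u i ^ 2 +
      2 * x * y * ∑ i, offInd u i * diffInd z u i + y ^ 2 * ∑ i, diffInd z u i ^ 2 := by
    intro k x y
    rw [hS, hD]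
    simp only [mul_add, mul_sum, ← sum_add_distrib, ← sum_sub_distrib]
    exact sum_congr rfl fun i _ => by ring
  rw [expand, sum_offInd_sq, sum_offInd_mul_diffInd huz, sum_diffInd_sq huz, ← hadef] at key
  have h3 : 0 < 2 * a - 3 := by linarith
  have : 0 ≤ (2 * a - 3) * ((2 * a - 3) * ∑ i, ξ i ^ 2 -
      (2 * S ^ 2 - 2 * S * D + (a - 1) * D ^ 2)) := by nlinarith [key]
  have := nonneg_of_mul_nonneg_right this h3
  linarith

/-- Completing the square in `D`: the first factor is the coefficient of `D ^ 2`, and what remains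
with `S ^ 2` is `(2 * a - 3) * extPoly a b l`. Thus the sign of `extPoly` decides semidefiniteness.
-/
theorem form_identity (a b l S D : ℝ) :
    (l * (a - 1) - 2 * (2 * a - 3)) * (l * (2 * S ^ 2 - 2 * S * D + (a - 1) * D ^ 2) -
      (2 * a - 3) * ((b - 1) * S ^ 2 - 2 * S * D + 2 * D ^ 2)) =
    ((l * (a - 1) - 2 * (2 * a - 3)) * D - (l - (2 * a - 3)) * S) ^ 2 +
      (2 * a - 3) * (l ^ 2 - ((a - 1) * (b - 1) + 2) * l + (2 * a - 3) * (2 * b - 3)) * S ^ 2 := by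
  ring

/-- The defining polynomial of the squared spectral radius of the extremal graph. -/
def extPoly (a b l : ℝ) : ℝ := l ^ 2 - ((a - 1) * (b - 1) + 2) * l + (2 * a - 3) * (2 * b - 3)

theorem form_le {a b l : ℝ} (ha : 2 ≤ a) (hl : 4 < l) (hg : 0 ≤ extPoly a b l) (S D : ℝ) :
    (2 * a - 3) * ((b - 1) * S ^ 2 - 2 * S * D + 2 * D ^ 2) ≤
      l * (2 * S ^ 2 - 2 * S * D + (a - 1) * D ^ 2) := by
  have hc : 0 < l * (a - 1) - 2 * (2 * a - 3) := by nlinarith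
  have h3 : 0 ≤ 2 * a - 3 := by linarith
  have h := form_identity a b l S D
  have : 0 ≤ (l * (a - 1) - 2 * (2 * a - 3)) *
      (l * (2 * S ^ 2 - 2 * S * D + (a - 1) * D ^ 2) -
        (2 * a - 3) * ((b - 1) * S ^ 2 - 2 * S * D + 2 * D ^ 2)) := by
    rw [h]
    have : 0 ≤ (2 * a - 3) * extPoly a b l * S ^ 2 := by positivity
    unfold extPoly at this
    positivity
  linarith [nonneg_of_mul_nonneg_right this hc]

theorem form_eq_zero {a b l : ℝ} (ha : 2 ≤ a) (hl : 4 < l) (hg : 0 < extPoly a b l) {S D : ℝ}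
    (h : l * (2 * S ^ 2 - 2 * S * D + (a - 1) * D ^ 2) ≤
      (2 * a - 3) * ((b - 1) * S ^ 2 - 2 * S * D + 2 * D ^ 2)) : S = 0 ∧ D = 0 := by
  have hc : 0 < l * (a - 1) - 2 * (2 * a - 3) := by nlinarith
  have h3 : 0 < 2 * a - 3 := by linarith
  have hid := form_identity a b l S D
  have hle : (l * (a - 1) - 2 * (2 * a - 3)) *
      (l * (2 * S ^ 2 - 2 * S * D + (a - 1) * D ^ 2) -
        (2 * a - 3) * ((b - 1) * S ^ 2 - 2 * S * D + 2 * D ^ 2)) ≤ 0 :=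
    mul_nonpos_of_nonneg_of_nonpos hc.le (by linarith)
  rw [hid] at hle
  have hpos : 0 < (2 * a - 3) * extPoly a b l := by positivity
  have hS : S = 0 := by
    by_contra hS
    have : 0 < (2 * a - 3) * extPoly a b l * S ^ 2 := by positivity
    unfold extPoly at this
    nlinarith [sq_nonneg ((l * (a - 1) - 2 * (2 * a - 3)) * D - (l - (2 * a - 3)) * S)]
  refine ⟨hS, ?_⟩
  subst hS
  have : ((l * (a - 1) - 2 * (2 * a - 3)) * D) ^ 2 ≤ 0 := by nlinarith
  have := pow_eq_zero_iff (two_ne_zero) |>.1 (le_antisymm this (sq_nonneg _))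
  exact (mul_eq_zero.1 this).resolve_left hc.ne'

/-- The squared norm bound for the extremal block, assuming the bound on its two-dimensional
compression. -/
theorem sum_sq_pathBlock_le {u z : X} (huz : u ≠ z) {v w : Y} (hvw : v ≠ w) {l : ℝ} (hl : 0 ≤ l)
    (hform : ∀ S D : ℝ, (2 * (Fintype.card X : ℝ) - 3) *
        (((Fintype.card Y : ℝ) - 1) * S ^ 2 - 2 * S * D + 2 * D ^ 2) ≤
      l * (2 * S ^ 2 - 2 * S * D + ((Fintype.card X : ℝ) - 1) * D ^ 2)) (ξ : X → ℝ) :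
    ∑ j, (∑ i, pathBlock u z v w i j * ξ i) ^ 2 ≤ l * ∑ i, ξ i ^ 2 := by
  rw [sum_sq_pathBlock u z hvw ξ rfl rfl]
  have h1 := gram_le huz ξ rfl rfl
  have ha : (2 : ℝ) ≤ Fintype.card X := by
    have : 1 < Fintype.card X := Fintype.one_lt_card_iff.2 ⟨u, z, huz⟩
    exact_mod_cast this
  have h2 := hform (∑ i, offInd u i * ξ i) (ξ z - ξ u)
  have h3 := mul_le_mul_of_nonneg_left h1 hl
  have h4 : 0 < 2 * (Fintype.card X : ℝ) - 3 := by linarith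
  refine le_of_mul_le_mul_left ?_ h4
  linarith

end Block

/-! ### Weighted sums over positive neighbours -/

section PosInd

variable {X : Type*} [DecidableEq X]

open Classical in
/-- The indicator function of the places where `f` equals `1`, minus the indicator function
of `u`. -/
noncomputable def posDiffInd (f : X → ℝ) (u i : X) : ℝ :=
  (if f i = 1 then 1 else 0) - (if i = u then 1 else 0)

variable [Fintype X]

theorem sum_mul_le_sum_posDiffInd {f ξ : X → ℝ} {u : X} (hf : ∀ i, f i = -1 ∨ f i = 0 ∨ f i = 1)
    (hu : f u = -1) (hξ : ∀ i, 0 ≤ ξ i) : ∑ i, f i * ξ i ≤ ∑ i, posDiffInd f u i * ξ i := by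
  refine sum_le_sum fun i _ => mul_le_mul_of_nonneg_right ?_ (hξ i)
  unfold posDiffInd
  by_cases h : i = u
  · subst h; rw [hu]; norm_num
  · rcases hf i with h' | h' | h' <;> rw [h'] <;> norm_num [h]

theorem sub_le_sum_posDiffInd {f ξ : X → ℝ} {u z : X} (hz : f z = 1) (hξ : ∀ i, 0 ≤ ξ i) :
    ξ z - ξ u ≤ ∑ i, posDiffInd f u i * ξ i := by
  rw [← sum_diffInd_mul]
  refine sum_le_sum fun i _ => mul_le_mul_of_nonneg_right ?_ (hξ i)
  unfold posDiffInd diffInd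
  by_cases h : i = z
  · subst h; simp [hz]
  · simp only [h, if_false]
    split_ifs <;> norm_num

theorem sum_posDiffInd_le {f ξ : X → ℝ} {u : X} (hu : f u = -1) (hξ : ∀ i, 0 ≤ ξ i)
    (h : ∀ i, f i = 1 → ξ i < ξ u) :
    ∑ i, posDiffInd f u i * ξ i ≤ ((Fintype.card X : ℝ) - 2) * ξ u := by
  have hle : ∀ i, posDiffInd f u i * ξ i ≤ (1 - 2 * if i = u then 1 else 0) * ξ u := by
    intro i
    unfold posDiffInd
    have := hξ u
    by_cases hi : i = u
    · subst hi; rw [hu]; norm_num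
    · by_cases h1 : f i = 1
      · have := h i h1
        simp [h1, hi, this.le]
      · simp [h1, hi, this]
  refine (sum_le_sum fun i _ => hle i).trans (le_of_eq ?_)
  rw [← sum_mul, sum_sub_distrib, ← mul_sum]
  simp

end PosInd

/-! ### Comparison of the quadratic form with the extremal block -/

section Compare

variable {X Y : Type*} [DecidableEq X] [DecidableEq Y]

/-- The only case with content is `i ≠ u`, `j ≠ v`, `M i v = M u j = 1`: the cycle through `u`, `v`,
`i`, `j` would be negative if `M i j` were positive. Elsewhere the right side is at least the
trivial bound. -/
theorem entry_le {M : X → Y → ℝ} (hM : ∀ i j, M i j = -1 ∨ M i j = 0 ∨ M i j = 1)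
    (hC : ∀ i i' j j', i ≠ i' → j ≠ j' → 0 ≤ M i j * M i j' * M i' j * M i' j')
    {u : X} {v : Y} (huv : M u v = -1) (i : X) (j : Y) :
    M i j ≤ offInd u i * offInd v j -
      posDiffInd (fun i => M i v) u i * posDiffInd (fun j => M u j) v j := by
  unfold offInd posDiffInd
  beta_reduce
  have hneg : ¬((-1 : ℝ) = 1) := by norm_num
  by_cases hi : i = u
  · subst hi
    by_cases hj : j = v
    · subst hj; simp [huv, hneg]
    · rcases hM i j with h | h | h <;> rw [h, huv] <;> norm_num [hj]
  · by_cases hj : j = v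
    · subst hj
      rcases hM i j with h | h | h <;> rw [h, huv] <;> norm_num [hi]
    · have hle : M i j ≤ 1 := by rcases hM i j with h | h | h <;> rw [h] <;> norm_num
      by_cases h1 : M i v = 1
      · by_cases h2 : M u j = 1
        · have := hC u i v j (Ne.symm hi) (Ne.symm hj)
          rw [huv, h1, h2] at this
          simp [hi, hj, h1, h2]
          linarith
        · simpa [hi, hj, h1, h2] using hle
      · simpa [hi, hj, h1] using hle

variable [Fintype X] [Fintype Y]

theorem sum_le_of_entry {M : X → Y → ℝ} (hM : ∀ i j, M i j = -1 ∨ M i j = 0 ∨ M i j = 1)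
    (hC : ∀ i i' j j', i ≠ i' → j ≠ j' → 0 ≤ M i j * M i j' * M i' j * M i' j')
    {u : X} {v : Y} (huv : M u v = -1) {ξ : X → ℝ} {η : Y → ℝ} (hξ : ∀ i, 0 ≤ ξ i)
    (hη : ∀ j, 0 ≤ η j) :
    ∑ i, ∑ j, M i j * ξ i * η j ≤ (∑ i, offInd u i * ξ i) * (∑ j, offInd v j * η j) -
      (∑ i, posDiffInd (fun i => M i v) u i * ξ i) *
        (∑ j, posDiffInd (fun j => M u j) v j * η j) := by
  rw [sum_mul_sum, sum_mul_sum, ← sum_sub_distrib]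
  refine sum_le_sum fun i _ => ?_
  rw [← sum_sub_distrib]
  refine sum_le_sum fun j _ => ?_
  have := mul_le_mul_of_nonneg_right (entry_le hM hC huv i j) (mul_nonneg (hξ i) (hη j))
  linarith

/-- Either the quadratic form of a signed biadjacency matrix with a negative entry is bounded by
that of an extremal block, or the singular value is small. -/
theorem exists_pathBlock_ge {M : X → Y → ℝ} (hM : ∀ i j, M i j = -1 ∨ M i j = 0 ∨ M i j = 1)
    (hC : ∀ i i' j j', i ≠ i' → j ≠ j' → 0 ≤ M i j * M i j' * M i' j * M i' j')
    {u : X} {v : Y} (huv : M u v = -1) (hrow : ∃ w, M u w = 1) (hcol : ∃ z, M z v = 1)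
    {ξ : X → ℝ} {η : Y → ℝ} (hξ : ∀ i, 0 ≤ ξ i) (hη : ∀ j, 0 ≤ η j) {μ : ℝ} (hμ : 0 < μ)
    (h1 : ∀ i, ∑ j, M i j * η j = μ * ξ i) (h2 : ∀ j, ∑ i, M i j * ξ i = μ * η j) :
    (∃ z w, M z v = 1 ∧ M u w = 1 ∧
      ∑ i, ∑ j, M i j * ξ i * η j ≤ ∑ i, ∑ j, pathBlock u z v w i j * ξ i * η j) ∨
    μ ^ 2 ≤ ((Fintype.card X : ℝ) - 2) * ((Fintype.card Y : ℝ) - 2) := by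
  have hs := sum_mul_le_sum_posDiffInd (fun i => hM i v) huv hξ
  have ht := sum_mul_le_sum_posDiffInd (hM u) huv hη
  rw [h2] at hs
  rw [h1] at ht
  have hform := sum_le_of_entry hM hC huv hξ hη
  have hzs : ∀ z, M z v = 1 → ξ z - ξ u ≤ ∑ i, posDiffInd (fun i => M i v) u i * ξ i :=
    fun z hz => sub_le_sum_posDiffInd (f := fun i => M i v) hz hξ
  have hwt : ∀ w, M u w = 1 → η w - η v ≤ ∑ j, posDiffInd (fun j => M u j) v j * η j :=
    fun w hw => sub_le_sum_posDiffInd (f := fun j => M u j) hw hη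
  have hs4 := sum_posDiffInd_le (f := fun i => M i v) huv hξ
  have ht4 := sum_posDiffInd_le (f := fun j => M u j) huv hη
  set s := ∑ i, posDiffInd (fun i => M i v) u i * ξ i
  set t := ∑ j, posDiffInd (fun j => M u j) v j * η j
  have hs0 : 0 ≤ s := (mul_nonneg hμ.le (hη v)).trans hs
  have ht0 : 0 ≤ t := (mul_nonneg hμ.le (hξ u)).trans ht
  -- If both differences `ξ z - ξ u`, `η w - η v` can be made nonnegative, their product is at most
  -- `s * t` factor by factor; if just one can, the product is nonpositive while `s * t ≥ 0`.
  by_cases hz : ∃ z, M z v = 1 ∧ ξ u ≤ ξ z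
  · left
    obtain ⟨z, hzv, hz⟩ := hz
    by_cases hw : ∃ w, M u w = 1 ∧ η v ≤ η w
    · obtain ⟨w, huw, hw⟩ := hw
      refine ⟨z, w, hzv, huw, ?_⟩
      rw [sum_sum_pathBlock]
      have := mul_le_mul (hzs z hzv) (hwt w huw) (by linarith) hs0
      linarith
    · push Not at hw
      obtain ⟨w, huw⟩ := hrow
      refine ⟨z, w, hzv, huw, ?_⟩
      rw [sum_sum_pathBlock]
      have := mul_nonneg hs0 ht0
      have := mul_nonneg (sub_nonneg.2 hz) (sub_nonneg.2 (hw w huw).le)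
      linarith
  · push Not at hz
    by_cases hw : ∃ w, M u w = 1 ∧ η v ≤ η w
    · left
      obtain ⟨w, huw, hw⟩ := hw
      obtain ⟨z, hzv⟩ := hcol
      refine ⟨z, w, hzv, huw, ?_⟩
      rw [sum_sum_pathBlock]
      have := mul_nonneg hs0 ht0
      have := mul_nonneg (sub_nonneg.2 (hz z hzv).le) (sub_nonneg.2 hw)
      linarith
    · right
      push Not at hw
      obtain ⟨w, huw⟩ := hrow
      obtain ⟨z, hzv⟩ := hcol
      have hu0 : 0 < ξ u := (hξ z).trans_lt (hz z hzv)
      have hv0 : 0 < η v := (hη w).trans_lt (hw w huw)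
      have a1 := hs.trans (hs4 hz)
      have a2 := ht.trans (ht4 hw)
      -- Multiply `μ * η v ≤ (|X| - 2) * ξ u` by `μ * ξ u ≤ (|Y| - 2) * η v` and cancel `ξ u * η v`.
      have := mul_le_mul a1 a2 (by positivity) ((by positivity : 0 ≤ μ * η v).trans a1)
      refine le_of_mul_le_mul_right ?_ (mul_pos hu0 hv0)
      linarith

end Compare

/-! ### Singular pairs and norm bounds -/

section Singular

variable {X Y : Type*} [Fintype X] [Fintype Y]

theorem sum_sq_eq_of_singular {M : X → Y → ℝ} {ξ : X → ℝ} {η : Y → ℝ} {μ : ℝ}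
    (h1 : ∀ i, ∑ j, M i j * η j = μ * ξ i) (h2 : ∀ j, ∑ i, M i j * ξ i = μ * η j) :
    ∑ i, ∑ j, M i j * ξ i * η j = μ * ∑ i, ξ i ^ 2 ∧
    ∑ i, ∑ j, M i j * ξ i * η j = μ * ∑ j, η j ^ 2 := by
  constructor
  · rw [mul_sum]
    refine sum_congr rfl fun i _ => ?_
    rw [show μ * ξ i ^ 2 = μ * ξ i * ξ i by ring, ← h1, sum_mul]
    exact sum_congr rfl fun j _ => by ring
  · rw [mul_sum, sum_comm]
    refine sum_congr rfl fun j _ => ?_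
    rw [show μ * η j ^ 2 = μ * η j * η j by ring, ← h2, sum_mul]

/-- If `‖Kᵀ ξ‖² ≤ B² ‖ξ‖²` and `⟪ξ, K η⟫` is at least `μ ‖ξ‖ ‖η‖` with `‖ξ‖ = ‖η‖`, then `μ ≤ B`,
with `Kᵀ ξ = B η` in case of equality. -/
theorem le_of_form {K : X → Y → ℝ} {ξ : X → ℝ} {η : Y → ℝ} {μ B N : ℝ} (hB : 0 < B)
    (hN : 0 < N) (hξ : ∑ i, ξ i ^ 2 = N) (hη : ∑ j, η j ^ 2 = N)
    (hK : ∑ j, (∑ i, K i j * ξ i) ^ 2 ≤ B ^ 2 * ∑ i, ξ i ^ 2)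
    (h : μ * N ≤ ∑ i, ∑ j, K i j * ξ i * η j) :
    μ ≤ B ∧ (μ = B → (∀ j, ∑ i, K i j * ξ i = B * η j) ∧
      ∑ i, ∑ j, K i j * ξ i * η j = B * N) := by
  have expand : ∑ j, (∑ i, K i j * ξ i - B * η j) ^ 2 =
      ∑ j, (∑ i, K i j * ξ i) ^ 2 - 2 * B * ∑ i, ∑ j, K i j * ξ i * η j + B ^ 2 * N := by
    rw [← hη, sum_comm, mul_sum, mul_sum, ← sum_sub_distrib, ← sum_add_distrib]
    refine sum_congr rfl fun j _ => ?_
    rw [← sum_mul]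
    ring
  have h0 : 0 ≤ ∑ j, (∑ i, K i j * ξ i - B * η j) ^ 2 := sum_nonneg fun _ _ => sq_nonneg _
  rw [hξ] at hK
  have hBN : ∑ i, ∑ j, K i j * ξ i * η j ≤ B * N := by
    refine le_of_mul_le_mul_left ?_ hB
    nlinarith
  refine ⟨le_of_mul_le_mul_right (h.trans hBN) hN, fun hμ => ?_⟩
  subst hμ
  have he := le_antisymm hBN h
  refine ⟨fun j => ?_, he⟩
  have h0' : ∑ j, (∑ i, K i j * ξ i - μ * η j) ^ 2 = 0 := le_antisymm (by rw [expand, he]; nlinarith) h0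
  have := (sum_eq_zero_iff_of_nonneg fun _ _ => sq_nonneg _).1 h0' j (mem_univ j)
  exact sub_eq_zero.1 (pow_eq_zero_iff two_ne_zero |>.1 this)

end Singular

theorem eq_of_sum_mul_eq {X : Type*} [Fintype X] {f g ξ : X → ℝ} (hfg : ∀ i, f i ≤ g i)
    (hξ : ∀ i, 0 ≤ ξ i) (h : ∑ i, f i * ξ i = ∑ i, g i * ξ i) {i : X} (hi : 0 < ξ i) :
    f i = g i := by
  have := (sum_eq_sum_iff_of_le fun i _ => mul_le_mul_of_nonneg_right (hfg i) (hξ i)).1 h i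
    (mem_univ i)
  exact mul_right_cancel₀ hi.ne' this

/-! ### The case of equality -/

section Rigidity

variable {X Y : Type*} [Fintype X] [DecidableEq X] [DecidableEq Y]

theorem singular_pos {u z : X} (huz : u ≠ z) {v w : Y} (hvw : v ≠ w) {ξ : X → ℝ} {η : Y → ℝ}
    {B : ℝ} (hB : 0 < B) (hξ : ∀ i, 0 ≤ ξ i) (hK : ∀ j, ∑ i, pathBlock u z v w i j * ξ i = B * η j)
    {i₀ : X} (hi₀ : i₀ ≠ u ∧ i₀ ≠ z) (hpos : 0 < ξ i₀) {j : Y} (hj : j ≠ v) : 0 < η j := by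
  have hS : ξ z + ξ i₀ ≤ ∑ i, offInd u i * ξ i := by
    have : ∑ i, ((if i = z then 1 else 0) + if i = i₀ then 1 else 0) * ξ i = ξ z + ξ i₀ := by
      simp [add_mul, sum_add_distrib]
    rw [← this]
    refine sum_le_sum fun i _ => mul_le_mul_of_nonneg_right ?_ (hξ i)
    unfold offInd
    by_cases h1 : i = z
    · subst h1; simp [huz.symm, hi₀.2.symm]
    · by_cases h2 : i = i₀
      · subst h2; simp [h1, hi₀.1]
      · simp only [h1, h2, if_false]; split_ifs <;> norm_num
  have h := hK j
  rw [sum_pathBlock_mul, sum_diffInd_mul] at h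
  have := hξ u
  have := hξ z
  have : 0 < B * η j := by
    rw [← h]
    by_cases hw : j = w
    · subst hw; rw [offInd_of_ne hj, diffInd_left hj]; linarith
    · rw [offInd_of_ne hj, diffInd_of_ne hw hj]; linarith
  exact pos_of_mul_pos_right this hB.le

theorem eq_zero_of_sum_offInd_eq_zero {Z : Type*} [Fintype Z] [DecidableEq Z] {p : Z} {f : Z → ℝ}
    (hf : ∀ k, 0 ≤ f k) (h : ∑ k, offInd p k * f k = 0) (k : Z) (hk : k ≠ p) : f k = 0 := by
  have h0 := (sum_eq_zero_iff_of_nonneg fun k _ => mul_nonneg (offInd_nonneg p k) (hf k)).1 h k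
    (mem_univ k)
  simpa [offInd_of_ne hk] using h0

theorem exists_ne_ne {X : Type*} [Fintype X] [DecidableEq X] (h : 3 ≤ Fintype.card X) (u z : X) :
    ∃ i, i ≠ u ∧ i ≠ z := by
  obtain ⟨i, hi⟩ := Finset.exists_mem_notMem_of_card_lt_card
    (s := ({u, z} : Finset X)) (t := univ) (by
      rw [card_univ]; exact (card_le_two).trans_lt h)
  exact ⟨i, by simpa using hi.2⟩

variable [Fintype Y]

/-- Once `M` is entrywise at most the block, equality of the weighted row and column sums forces
equality of entries wherever the weight is positive. The weights are positive off `u` and `v`, which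
covers every entry except `(u, v)`, known in advance. The domination holds first in row `z` and
column `w`; equality there feeds the 4-cycle condition and yields it in row `u` and column `v`. -/
theorem eq_pathBlock {M : X → Y → ℝ} (hM : ∀ i j, M i j = -1 ∨ M i j = 0 ∨ M i j = 1)
    (hC : ∀ i i' j j', i ≠ i' → j ≠ j' → 0 ≤ M i j * M i j' * M i' j * M i' j')
    {u z : X} {v w : Y} (huv : M u v = -1) (hzv : M z v = 1) (huw : M u w = 1)
    {ξ : X → ℝ} {η : Y → ℝ} (hξ : ∀ i, 0 ≤ ξ i) (hη : ∀ j, 0 ≤ η j) (hne : ξ ≠ 0)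
    {B : ℝ} (hB : 0 < B) (h1 : ∀ i, ∑ j, M i j * η j = B * ξ i)
    (h2 : ∀ j, ∑ i, M i j * ξ i = B * η j)
    (hK1 : ∀ i, ∑ j, pathBlock u z v w i j * η j = B * ξ i)
    (hK2 : ∀ j, ∑ i, pathBlock u z v w i j * ξ i = B * η j)
    (hX : 3 ≤ Fintype.card X) (hY : 3 ≤ Fintype.card Y) : M = pathBlock u z v w := by
  have huz : u ≠ z := by rintro rfl; rw [huv] at hzv; norm_num at hzv
  have hvw : v ≠ w := by rintro rfl; rw [huv] at huw; norm_num at huw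
  obtain ⟨i₀, hi₀⟩ := exists_ne_ne hX u z
  obtain ⟨j₀, hj₀⟩ := exists_ne_ne hY v w
  have hK1' : ∀ i, ∑ j, pathBlock v w u z j i * η j = B * ξ i := fun i => by
    simp_rw [pathBlock_swap u z v w]; exact hK1 i
  have hrow : ∀ i, B * ξ i = offInd u i * (∑ j, offInd v j * η j) - diffInd z u i * (η w - η v) :=
    fun i => by rw [← hK1' i, sum_pathBlock_mul, sum_diffInd_mul]
  have hcol : ∀ j, B * η j = offInd v j * (∑ i, offInd u i * ξ i) - diffInd w v j * (ξ z - ξ u) :=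
    fun j => by rw [← hK2 j, sum_pathBlock_mul, sum_diffInd_mul]
  have hTi : B * ξ i₀ = ∑ j, offInd v j * η j := by
    rw [hrow, offInd_of_ne hi₀.1, diffInd_of_ne hi₀.2 hi₀.1]; ring
  have hSj : B * η j₀ = ∑ i, offInd u i * ξ i := by
    rw [hcol, offInd_of_ne hj₀.1, diffInd_of_ne hj₀.2 hj₀.1]; ring
  -- If `ξ i₀ = 0`, then `η` vanishes off `v`, hence `ξ` vanishes off `u`, and row `u` of the block
  -- gives `B * ξ u = -η v ≤ 0`, so `ξ = 0`.
  have hi₀pos : 0 < ξ i₀ := by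
    refine (hξ i₀).lt_of_ne fun h0 => hne ?_
    rw [← h0, mul_zero] at hTi
    have hη0 := eq_zero_of_sum_offInd_eq_zero hη hTi.symm
    rw [hη0 j₀ hj₀.1, mul_zero] at hSj
    have hξ0 := eq_zero_of_sum_offInd_eq_zero hξ hSj.symm
    have hu := hrow u
    rw [offInd_self, diffInd_right huz, hη0 w hvw.symm] at hu
    have hu0 : ξ u = 0 := by
      refine le_antisymm ?_ (hξ u)
      have := hη v
      have : B * ξ u ≤ 0 := by linarith
      exact nonpos_of_mul_nonpos_right this hB
    funext i
    by_cases hi : i = u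
    · rw [hi, hu0]; rfl
    · exact hξ0 i hi
  have hηpos : ∀ j, j ≠ v → 0 < η j := fun j hj => singular_pos huz hvw hB hξ hK2 hi₀ hi₀pos hj
  have hξpos : ∀ i, i ≠ u → 0 < ξ i := fun i hi =>
    singular_pos hvw huz hB hη hK1' hj₀ (hηpos j₀ hj₀.1) hi
  have hle1 : ∀ i j, M i j ≤ 1 := by
    intro i j
    rcases hM i j with h | h | h <;> rw [h] <;> norm_num
  have hzw : M z w ≤ 0 := by
    have := hC u z v w huz hvw
    rw [huv, hzv, huw] at this
    linarith
  have hz : ∀ j, M z j ≤ pathBlock u z v w z j := by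
    intro j
    unfold pathBlock
    rw [offInd_of_ne huz.symm, diffInd_left huz.symm]
    by_cases h : j = v
    · subst h; rw [offInd_self, diffInd_right hvw, hzv]; norm_num
    · by_cases h' : j = w
      · subst h'; rw [offInd_of_ne h, diffInd_left h]; linarith
      · rw [offInd_of_ne h, diffInd_of_ne h' h]; linarith [hle1 z j]
  have hw : ∀ i, M i w ≤ pathBlock u z v w i w := by
    intro i
    unfold pathBlock
    rw [offInd_of_ne hvw.symm, diffInd_left hvw.symm]
    by_cases h : i = u
    · subst h; rw [offInd_self, diffInd_right huz, huw]; norm_num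
    · by_cases h' : i = z
      · subst h'; rw [offInd_of_ne h, diffInd_left h]; linarith
      · rw [offInd_of_ne h, diffInd_of_ne h' h]; linarith [hle1 i w]
  have hrowu : ∀ j, j ≠ v → j ≠ w → M u j ≤ 0 := by
    intro j h h'
    have e := eq_of_sum_mul_eq hz hη ((h1 z).trans (hK1 z).symm) (hηpos j h)
    have hval : pathBlock u z v w z j = 1 := by
      unfold pathBlock
      rw [offInd_of_ne huz.symm, offInd_of_ne h, diffInd_of_ne h' h]; norm_num
    have := hC u z v j huz h.symm
    rw [huv, hzv, e, hval] at this
    linarith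
  have hcolv : ∀ i, i ≠ u → i ≠ z → M i v ≤ 0 := by
    intro i h h'
    have e := eq_of_sum_mul_eq hw hξ ((h2 w).trans (hK2 w).symm) (hξpos i h)
    have hval : pathBlock u z v w i w = 1 := by
      unfold pathBlock
      rw [offInd_of_ne hvw.symm, offInd_of_ne h, diffInd_of_ne h' h]; norm_num
    have := hC u i v w h.symm hvw
    rw [huv, huw, e, hval] at this
    linarith
  have hle : ∀ i j, M i j ≤ pathBlock u z v w i j := by
    intro i j
    by_cases hj : j = w
    · subst hj; exact hw i
    by_cases hi : i = z
    · subst hi; exact hz j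
    unfold pathBlock
    by_cases hiu : i = u
    · subst hiu
      rw [offInd_self, diffInd_right huz]
      by_cases hjv : j = v
      · subst hjv; rw [diffInd_right hvw, huv]; norm_num
      · rw [diffInd_of_ne hj hjv]; linarith [hrowu j hjv hj]
    · rw [diffInd_of_ne hi hiu, offInd_of_ne hiu]
      by_cases hjv : j = v
      · subst hjv; rw [offInd_self]; linarith [hcolv i hiu hi]
      · rw [offInd_of_ne hjv]; linarith [hle1 i j]
  funext i j
  by_cases hi : i = u
  · by_cases hj : j = v
    · rw [hi, hj, huv, pathBlock, offInd_self, offInd_self, diffInd_right huz, diffInd_right hvw]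
      norm_num
    · exact eq_of_sum_mul_eq (hle i) hη ((h1 i).trans (hK1 i).symm) (hηpos j hj)
  · exact eq_of_sum_mul_eq (fun i => hle i j) hξ ((h2 j).trans (hK2 j).symm) (hξpos i hi)

theorem singular_value_le {M : X → Y → ℝ} (hM : ∀ i j, M i j = -1 ∨ M i j = 0 ∨ M i j = 1)
    (hC : ∀ i i' j j', i ≠ i' → j ≠ j' → 0 ≤ M i j * M i j' * M i' j * M i' j')
    {u : X} {v : Y} (huv : M u v = -1) (hrow : ∃ w, M u w = 1) (hcol : ∃ z, M z v = 1)
    {ξ : X → ℝ} {η : Y → ℝ} (hξ : ∀ i, 0 ≤ ξ i) (hη : ∀ j, 0 ≤ η j) (hne : ξ ≠ 0)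
    {μ : ℝ} (hμ : 0 < μ) (h1 : ∀ i, ∑ j, M i j * η j = μ * ξ i)
    (h2 : ∀ j, ∑ i, M i j * ξ i = μ * η j) {B : ℝ} (hB : 0 < B) (hB4 : 4 < B ^ 2)
    (hsmall : ((Fintype.card X : ℝ) - 2) * ((Fintype.card Y : ℝ) - 2) < B ^ 2)
    (hpoly : 0 ≤ extPoly (Fintype.card X) (Fintype.card Y) (B ^ 2)) :
    μ ≤ B ∧ (μ = B → extPoly (Fintype.card X) (Fintype.card Y) (B ^ 2) = 0 ∧
      (3 ≤ Fintype.card X → 3 ≤ Fintype.card Y →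
        ∃ z w, u ≠ z ∧ v ≠ w ∧ M = pathBlock u z v w)) := by
  rcases exists_pathBlock_ge hM hC huv hrow hcol hξ hη hμ h1 h2 with ⟨z, w, hzv, huw, hle⟩ | hle
  swap
  · have hlt : μ < B := lt_of_pow_lt_pow_left₀ 2 hB.le (hle.trans_lt hsmall)
    exact ⟨hlt.le, fun h => absurd h hlt.ne⟩
  have huz : u ≠ z := by rintro rfl; rw [huv] at hzv; norm_num at hzv
  have hvw : v ≠ w := by rintro rfl; rw [huv] at huw; norm_num at huw
  have ha : (2 : ℝ) ≤ Fintype.card X := by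
    have : 1 < Fintype.card X := Fintype.one_lt_card_iff.2 ⟨u, z, huz⟩
    exact_mod_cast this
  have hb : (2 : ℝ) ≤ Fintype.card Y := by
    have : 1 < Fintype.card Y := Fintype.one_lt_card_iff.2 ⟨v, w, hvw⟩
    exact_mod_cast this
  obtain ⟨e1, e2⟩ := sum_sq_eq_of_singular h1 h2
  have hN : 0 < ∑ i, ξ i ^ 2 := by
    obtain ⟨i, hi⟩ := Function.ne_iff.1 hne
    exact sum_pos' (fun _ _ => sq_nonneg _) ⟨i, mem_univ i, pow_pos ((hξ i).lt_of_ne' hi) 2⟩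
  have hηN : ∑ j, η j ^ 2 = ∑ i, ξ i ^ 2 := mul_left_cancel₀ hμ.ne' (e2.symm.trans e1)
  rw [e1] at hle
  have hpoly' : 0 ≤ extPoly (Fintype.card Y) (Fintype.card X) (B ^ 2) := by
    unfold extPoly at hpoly ⊢; linarith
  have hKξ := sum_sq_pathBlock_le huz hvw (sq_nonneg B) (form_le ha hB4 hpoly) ξ
  have hKη := sum_sq_pathBlock_le hvw huz (sq_nonneg B) (form_le hb hB4 hpoly') η
  simp_rw [pathBlock_swap u z v w] at hKη
  obtain ⟨hμB, heq⟩ := le_of_form hB hN rfl hηN hKξ hle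
  refine ⟨hμB, fun h => ?_⟩
  have hK2 := (heq h).1
  have hK1 := ((le_of_form (K := fun j i => pathBlock u z v w i j) hB hN hηN rfl hKη (by
    rw [sum_comm]
    refine hle.trans (le_of_eq ?_)
    exact sum_congr rfl fun i _ => sum_congr rfl fun j _ => by ring)).2 h).1
  subst h
  constructor
  -- With `extPoly` positive the binary form is definite, so equality makes `S = D = 0`; then the
  -- block kills `ξ`, although the image has squared norm `μ ^ 2 * ‖ξ‖ ^ 2 > 0`.
  · by_contra hpoly0
    have hpos := lt_of_le_of_ne hpoly (Ne.symm hpoly0)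
    have hsq := sum_sq_pathBlock u z hvw ξ rfl rfl
    have hgram := gram_le huz ξ rfl rfl
    have hval : ∑ j, (∑ i, pathBlock u z v w i j * ξ i) ^ 2 = μ ^ 2 * ∑ i, ξ i ^ 2 := by
      simp_rw [hK2, mul_pow]
      rw [← mul_sum, hηN]
    obtain ⟨hS, hD⟩ := form_eq_zero ha hB4 hpos (S := ∑ i, offInd u i * ξ i) (D := ξ z - ξ u) (by
      rw [← hsq, hval]
      have := mul_le_mul_of_nonneg_left hgram (sq_nonneg μ)
      linarith)
    rw [hval, hS, hD] at hsq
    have : 0 < μ ^ 2 * ∑ i, ξ i ^ 2 := by positivity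
    linarith
  · intro hX hY
    exact ⟨z, w, huz, hvw, eq_pathBlock hM hC huv hzv huw hξ hη hne hB h1 h2 hK1 hK2 hX hY⟩

end Rigidity

/-! ### Choice of the switching -/

section Switching

variable {V : Type*}

/-- The entry of a signed adjacency matrix after switching by a sign function. -/
def switchEntry (A : V → V → ℝ) (θ : V → ℤˣ) (p q : V) : ℝ :=
  ((θ p : ℤ) : ℝ) * ((θ q : ℤ) : ℝ) * A p q

theorem unit_cast_sq (ε : ℤˣ) : ((ε : ℤ) : ℝ) * ((ε : ℤ) : ℝ) = 1 := by
  rcases Int.units_eq_one_or ε with h | h <;> simp [h]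

theorem switchEntry_mem {A : V → V → ℝ} (hA : ∀ p q, A p q = -1 ∨ A p q = 0 ∨ A p q = 1)
    (θ : V → ℤˣ) (p q : V) :
    switchEntry A θ p q = -1 ∨ switchEntry A θ p q = 0 ∨ switchEntry A θ p q = 1 := by
  unfold switchEntry
  rcases Int.units_eq_one_or (θ p) with h | h <;> rcases Int.units_eq_one_or (θ q) with h' | h' <;>
    rcases hA p q with h'' | h'' | h'' <;> simp [h, h', h'']

/-- A nonnegative switching of an eigenvector can be chosen so that each of the two ends of some
negative edge is incident to a positive edge. -/
theorem exists_switching [Fintype V] {A : V → V → ℝ} (hA : ∀ p q, A p q = -1 ∨ A p q = 0 ∨ A p q = 1)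
    (hsymm : ∀ p q, A p q = A q p) (hdiag : ∀ p, A p p = 0)
    (hunb : ∀ θ : V → ℤˣ, ∃ p q, switchEntry A θ p q = -1)
    {x : V → ℝ} {μ : ℝ} (hμ : 0 < μ) (hx : ∀ p, ∑ q, A p q * x q = μ * x p) :
    ∃ θ : V → ℤˣ, (∀ p, 0 ≤ ((θ p : ℤ) : ℝ) * x p) ∧ ∃ p q, switchEntry A θ p q = -1 ∧
      (∃ r, switchEntry A θ p r = 1) ∧ ∃ r, switchEntry A θ q r = 1 := by
  classical
  obtain ⟨θ, hθ, hmin⟩ := Finset.exists_min_image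
    (univ.filter fun θ : V → ℤˣ => ∀ p, 0 ≤ ((θ p : ℤ) : ℝ) * x p)
    (fun θ => (univ.filter fun pq : V × V => switchEntry A θ pq.1 pq.2 = -1).card)
    ⟨fun p => if 0 ≤ x p then 1 else -1, by
      simp only [mem_filter, mem_univ, true_and]
      intro p
      split_ifs with h
      · simpa using h
      · simpa using (not_le.1 h).le⟩
  simp only [mem_filter, mem_univ, true_and] at hθ hmin
  have hS : ∀ p q, switchEntry A θ p q = switchEntry A θ q p := fun p q => by
    unfold switchEntry; rw [hsymm p q]; ring
  have key : ∀ p q, switchEntry A θ p q = -1 → ∃ r, switchEntry A θ p r = 1 := by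
    intro p q hpq
    by_contra hno
    push Not at hno
    -- Without a positive edge at `p`, the eigenvalue equation at `p` has a nonpositive left side
    -- and a nonnegative right side. Hence `p` may be switched freely, which removes its negative
    -- edges and contradicts minimality.
    have hxp : x p = 0 := by
      have hle : ((θ p : ℤ) : ℝ) * ∑ q, A p q * x q ≤ 0 := by
        rw [mul_sum]
        refine sum_nonpos fun r _ => ?_
        have : ((θ p : ℤ) : ℝ) * (A p r * x r) = switchEntry A θ p r * (((θ r : ℤ) : ℝ) * x r) := by
          unfold switchEntry
          linear_combination (-((θ p : ℤ) : ℝ) * A p r * x r) * unit_cast_sq (θ r)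
        rw [this]
        refine mul_nonpos_of_nonpos_of_nonneg ?_ (hθ r)
        rcases switchEntry_mem hA θ p r with h | h | h
        · rw [h]; norm_num
        · rw [h]
        · exact absurd h (hno r)
      rw [hx] at hle
      have h0 : ((θ p : ℤ) : ℝ) * x p = 0 :=
        le_antisymm (nonpos_of_mul_nonpos_right (by linarith) hμ) (hθ p)
      rcases mul_eq_zero.1 h0 with h | h
      · simp at h
      · exact h
    set θ' := Function.update θ p (-θ p) with hθ'
    have hne : ∀ r, r ≠ p → θ' r = θ r := fun r hr => Function.update_of_ne hr _ _
    have hself : θ' p = -θ p := Function.update_self _ _ _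
    have hrow : ∀ r, switchEntry A θ' p r = -switchEntry A θ p r := by
      intro r
      unfold switchEntry
      by_cases hr : r = p
      · subst hr; rw [hdiag]; simp
      · rw [hself, hne r hr]; push_cast; ring
    have hS' : ∀ p q, switchEntry A θ' p q = switchEntry A θ' q p := fun p q => by
      unfold switchEntry; rw [hsymm p q]; ring
    have hlt : (univ.filter fun pq : V × V => switchEntry A θ' pq.1 pq.2 = -1) ⊂
        univ.filter fun pq : V × V => switchEntry A θ pq.1 pq.2 = -1 := by
      refine Finset.ssubset_iff_of_subset (fun pq => ?_) |>.2 ⟨(p, q), by simpa using hpq, ?_⟩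
      · simp only [mem_filter, mem_univ, true_and]
        intro h
        by_cases h1 : pq.1 = p
        · rw [h1, hrow] at h
          exact absurd (neg_injective h) (hno _)
        · by_cases h2 : pq.2 = p
          · rw [h2, hS', hrow] at h
            exact absurd (neg_injective h) (hno _)
          · unfold switchEntry at h ⊢
            rwa [hne _ h1, hne _ h2] at h
      · simp only [mem_filter, mem_univ, true_and]
        rw [hrow, hpq]
        norm_num
    refine absurd (hmin θ' fun r => ?_) (not_le.2 (card_lt_card hlt))
    by_cases hr : r = p
    · subst hr; rw [hxp, mul_zero]
    · rw [hne r hr]; exact hθ r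
  obtain ⟨p, q, hpq⟩ := hunb θ
  exact ⟨θ, hθ, p, q, hpq, key p q hpq, key q p (by rw [hS]; exact hpq)⟩

end Switching


/-! ### From eigenvectors to singular pairs -/

section Bipartite

variable {V : Type*} [Fintype V] [DecidableEq V]

theorem eigenvalue_le {A : V → V → ℝ} (hA : ∀ p q, A p q = -1 ∨ A p q = 0 ∨ A p q = 1)
    (hsymm : ∀ p q, A p q = A q p) (hdiag : ∀ p, A p p = 0)
    (hunb : ∀ θ : V → ℤˣ, ∃ p q, switchEntry A θ p q = -1)
    (hC : ∀ p p' q q', p ≠ p' → q ≠ q' → 0 ≤ A p q * A p q' * A p' q * A p' q')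
    (s : V → Prop) [DecidablePred s] (hs : ∀ p q, A p q ≠ 0 → (s p ↔ ¬ s q))
    {x : V → ℝ} (hx0 : x ≠ 0) {μ : ℝ} (hμ : 0 < μ) (hx : ∀ p, ∑ q, A p q * x q = μ * x p)
    {a b : ℕ} (ha : Fintype.card {p // s p} = a) (hb : Fintype.card {p // ¬ s p} = b)
    {B : ℝ} (hB : 0 < B) (hB4 : 4 < B ^ 2) (hsmall : ((a : ℝ) - 2) * ((b : ℝ) - 2) < B ^ 2)
    (hpoly : 0 ≤ extPoly a b (B ^ 2)) :
    μ ≤ B ∧ (μ = B → extPoly a b (B ^ 2) = 0 ∧ (3 ≤ a → 3 ≤ b →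
      ∃ (θ : V → ℤˣ) (u z : {p // s p}) (v w : {p // ¬ s p}), u ≠ z ∧ v ≠ w ∧
        ∀ (i : {p // s p}) (j : {p // ¬ s p}), switchEntry A θ i j = pathBlock u z v w i j)) := by
  obtain ⟨θ, hθ, p, q, hpq, hp, hq⟩ := exists_switching hA hsymm hdiag hunb hμ hx
  have hS : ∀ p q, switchEntry A θ p q = switchEntry A θ q p := fun p q => by
    unfold switchEntry; rw [hsymm p q]; ring
  have hAS : ∀ p q, switchEntry A θ p q ≠ 0 → (s p ↔ ¬ s q) := fun p q h =>
    hs p q fun h0 => h (by unfold switchEntry; rw [h0, mul_zero])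
  wlog hsp : s p generalizing p q
  · exact this q p (by rw [hS]; exact hpq) hq hp
      (by have := hAS p q (by rw [hpq]; norm_num); tauto)
  have hsq : ¬ s q := (hAS p q (by rw [hpq]; norm_num)).1 hsp
  subst ha hb
  have heig : ∀ p, ∑ q, switchEntry A θ p q * (((θ q : ℤ) : ℝ) * x q) =
      μ * (((θ p : ℤ) : ℝ) * x p) := by
    intro p
    rw [mul_left_comm, ← hx p, mul_sum]
    refine sum_congr rfl fun r _ => ?_
    unfold switchEntry
    linear_combination (((θ p : ℤ) : ℝ) * A p r * x r) * unit_cast_sq (θ r)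
  have hsplit := fun p => Fintype.sum_subtype_add_sum_subtype s
    fun q => switchEntry A θ p q * (((θ q : ℤ) : ℝ) * x q)
  have h1 : ∀ i : {p // s p}, ∑ j : {p // ¬ s p}, switchEntry A θ i j *
      (((θ j : ℤ) : ℝ) * x j) = μ * (((θ i : ℤ) : ℝ) * x i) := by
    intro i
    rw [← heig, ← hsplit, right_eq_add]
    refine sum_eq_zero fun j _ => ?_
    by_contra h
    exact (hAS i j (left_ne_zero_of_mul h)).1 i.2 j.2
  have h2 : ∀ j : {p // ¬ s p}, ∑ i : {p // s p}, switchEntry A θ i j *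
      (((θ i : ℤ) : ℝ) * x i) = μ * (((θ j : ℤ) : ℝ) * x j) := by
    intro j
    rw [← heig, ← hsplit]
    rw [show (∑ i : {p // s p}, switchEntry A θ i j * (((θ i : ℤ) : ℝ) * x i)) =
      ∑ i : {p // s p}, switchEntry A θ j i * (((θ i : ℤ) : ℝ) * x i) from
      sum_congr rfl fun i _ => by rw [hS]]
    rw [left_eq_add]
    refine sum_eq_zero fun i _ => ?_
    by_contra h
    exact j.2 ((hAS j i (left_ne_zero_of_mul h)).2 i.2)
  have hcast : ∀ p, ((θ p : ℤ) : ℝ) ≠ 0 := fun p => by simp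
  have hne : (fun i : {p // s p} => ((θ i : ℤ) : ℝ) * x i) ≠ 0 := by
    intro h0
    refine hx0 (funext fun r => ?_)
    have h0' : ∀ r, s r → x r = 0 := fun r hr => by
      have := congrFun h0 ⟨r, hr⟩
      exact (mul_eq_zero.1 this).resolve_left (hcast r)
    by_cases hr : s r
    · exact h0' r hr
    · have := h2 ⟨r, hr⟩
      rw [sum_eq_zero fun i _ => by rw [h0' i i.2]; simp] at this
      exact ((mul_eq_zero.1 ((mul_eq_zero.1 this.symm).resolve_left hμ.ne')).resolve_left (hcast r))
  obtain ⟨hle, heq⟩ := singular_value_le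
    (M := fun (i : {p // s p}) (j : {p // ¬ s p}) => switchEntry A θ i j)
    (fun i j => switchEntry_mem hA θ i j) (u := ⟨p, hsp⟩) (v := ⟨q, hsq⟩) (by
      intro i i' j j' hi hj
      have := hC i i' j j' (fun h => hi (Subtype.ext h)) (fun h => hj (Subtype.ext h))
      refine this.trans_eq ?_
      unfold switchEntry
      have a1 := unit_cast_sq (θ i)
      have a2 := unit_cast_sq (θ i')
      have a3 := unit_cast_sq (θ j)
      have a4 := unit_cast_sq (θ j')
      calc _ = 1 * 1 * 1 * 1 * (A i j * A i j' * A i' j * A i' j') := by ring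
        _ = _ := by
          nth_rewrite 1 [← a1]
          nth_rewrite 1 [← a2]
          nth_rewrite 1 [← a3]
          nth_rewrite 1 [← a4]
          ring) hpq
    (by
      obtain ⟨r, hr⟩ := hp
      exact ⟨⟨r, (hAS p r (by rw [hr]; norm_num)).1 hsp⟩, hr⟩)
    (by
      obtain ⟨r, hr⟩ := hq
      have := hAS q r (by rw [hr]; norm_num)
      exact ⟨⟨r, by tauto⟩, by rw [hS]; exact hr⟩)
    (fun i => hθ i) (fun j => hθ j) hne hμ h1 h2 hB hB4 hsmall hpoly
  refine ⟨hle, fun h => ⟨(heq h).1, fun h3 h3' => ?_⟩⟩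
  obtain ⟨z, w, hz, hw, hM⟩ := (heq h).2 h3 h3'
  exact ⟨θ, _, z, _, w, hz, hw, fun i j => congrFun (congrFun hM i) j⟩

end Bipartite

/-! ### The numerical bound as a function of the order -/

section Bound

/-- The bound on the spectral radius, in terms of the order. -/
noncomputable def rhoBound (n : ℕ) : ℝ :=
  if Even n then
    (1 / 4 : ℝ) * ((n : ℝ) - 6 + √(((n : ℝ) - 2) * ((n : ℝ) + 6)))
  else
    √((1 / 8 : ℝ) * ((n : ℝ) ^ 2 - 4 * (n : ℝ) + 11 +
      √(((n : ℝ) ^ 2 - 4 * (n : ℝ) + 11) ^ 2 - 64 * ((n : ℝ) - 2) * ((n : ℝ) - 4))))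

theorem rhoBound_two_mul {r : ℕ} :
    rhoBound (2 * r) = ((r : ℝ) - 3 + √(((r : ℝ) - 1) * ((r : ℝ) + 3))) / 2 := by
  unfold rhoBound
  rw [if_pos (even_two_mul r)]
  have : ((2 * r : ℕ) - 2 : ℝ) * ((2 * r : ℕ) + 6) = 2 ^ 2 * (((r : ℝ) - 1) * ((r : ℝ) + 3)) := by
    push_cast; ring
  rw [this, Real.sqrt_mul (by norm_num), Real.sqrt_sq (by norm_num)]
  push_cast
  ring

theorem rhoBound_even_facts {r : ℕ} (hr : 3 ≤ r) :
    0 < rhoBound (2 * r) ∧ rhoBound (2 * r) ^ 2 = ((r : ℝ) - 3) * rhoBound (2 * r) + (2 * r - 3) ∧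
      (4 ≤ r → 2 < rhoBound (2 * r)) := by
  have hr' : (3 : ℝ) ≤ r := by exact_mod_cast hr
  rw [rhoBound_two_mul]
  have h0 : 0 ≤ ((r : ℝ) - 1) * ((r : ℝ) + 3) := by nlinarith
  have hsq := Real.sq_sqrt h0
  have h3 : 3 < √(((r : ℝ) - 1) * ((r : ℝ) + 3)) := Real.lt_sqrt_of_sq_lt (by nlinarith)
  refine ⟨by linarith, by linear_combination (1 / 4) * hsq, fun h4 => ?_⟩
  have : (4 : ℝ) ≤ r := by exact_mod_cast h4
  linarith

theorem rhoBound_odd_facts {r : ℕ} (hr : 3 ≤ r) : 0 < rhoBound (2 * r + 1) ∧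
    extPoly r ((r : ℝ) + 1) (rhoBound (2 * r + 1) ^ 2) = 0 ∧ 4 < rhoBound (2 * r + 1) ^ 2 := by
  have hr' : (3 : ℝ) ≤ r := by exact_mod_cast hr
  unfold rhoBound
  rw [if_neg (by simp)]
  push_cast
  set m : ℝ := (2 * (r : ℝ) + 1) ^ 2 - 4 * (2 * r + 1) + 11 with hm
  have hm32 : 32 ≤ m := by nlinarith
  have hdisc : 0 < m ^ 2 - 64 * (2 * (r : ℝ) + 1 - 2) * (2 * (r : ℝ) + 1 - 4) := by
    nlinarith [sq_nonneg (m - 32)]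
  have hsq := Real.sq_sqrt hdisc.le
  have hpos := Real.sqrt_pos.2 hdisc
  set q := √(m ^ 2 - 64 * (2 * (r : ℝ) + 1 - 2) * (2 * (r : ℝ) + 1 - 4))
  have h0 : 0 < 1 / 8 * (m + q) := by positivity
  refine ⟨Real.sqrt_pos.2 h0, ?_, ?_⟩
  · rw [Real.sq_sqrt h0.le]
    unfold extPoly
    rw [hm] at hsq ⊢
    linear_combination (1 / 64) * hsq
  · rw [Real.sq_sqrt h0.le]; linarith

theorem rhoBound_facts {n : ℕ} (hn : 6 ≤ n) : 0 < rhoBound n ∧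
    extPoly (n / 2 : ℕ) ((n + 1) / 2 : ℕ) (rhoBound n ^ 2) = 0 ∧
    (7 ≤ n → 4 < rhoBound n ^ 2) ∧ (n = 6 → rhoBound n ^ 2 = 3) := by
  obtain ⟨r, rfl | rfl⟩ := Nat.even_or_odd' n
  · have e1 : 2 * r / 2 = r := by omega
    have e2 : (2 * r + 1) / 2 = r := by omega
    rw [e1, e2]
    obtain ⟨h0, h1, h2⟩ := rhoBound_even_facts (r := r) (by omega)
    refine ⟨h0, ?_, fun h => ?_, fun h => ?_⟩
    · unfold extPoly
      rw [h1]
      -- For equal parts `extPoly r r (B ^ 2)` is the difference of squares `(B ^ 2 - (2 * r - 3)) ^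
      -- 2 - ((r - 3) * B) ^ 2`; the bound is a root of one factor.
      linear_combination ((r : ℝ) - 3) ^ 2 * h1
    · have := h2 (by omega)
      nlinarith
    · have : r = 3 := by omega
      subst this
      rw [h1]; norm_num
  · have e1 : (2 * r + 1) / 2 = r := by omega
    have e2 : (2 * r + 1 + 1) / 2 = r + 1 := by omega
    rw [e1, e2]
    obtain ⟨h0, h1, h2⟩ := rhoBound_odd_facts (r := r) (by omega)
    refine ⟨h0, by push_cast; exact h1, fun _ => h2, fun h => by omega⟩

/-- For given `n` and `l` this is affine in `a * b` with slope `4 - l`; hence the role of the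
condition `l > 4`. -/
theorem extPoly_add_eq {n a b : ℕ} (hab : a + b = n) (l : ℝ) :
    extPoly a b l = l ^ 2 - ((a * b : ℕ) - (n : ℝ) + 3) * l + 4 * (a * b : ℕ) - 6 * n + 9 := by
  subst hab
  unfold extPoly
  push_cast
  ring

theorem mul_le_div_mul_div {n a b : ℕ} (hab : a + b = n) (hle : a ≤ b) :
    a * b ≤ n / 2 * ((n + 1) / 2) ∧ (a * b = n / 2 * ((n + 1) / 2) → a = n / 2) := by
  obtain ⟨k, hk⟩ : ∃ k, n / 2 = a + k := ⟨n / 2 - a, by omega⟩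
  have ht : b = (n + 1) / 2 + k := by omega
  have h1 : n / 2 ≤ (n + 1) / 2 := by omega
  rw [hk] at h1 ⊢
  generalize (n + 1) / 2 = t at *
  subst ht
  have key : (a + k) * t = a * (t + k) + k * (t - a) := by
    obtain ⟨d, rfl⟩ : ∃ d, t = a + d := ⟨t - a, by omega⟩
    rw [Nat.add_sub_cancel_left]; ring
  refine ⟨by rw [key]; exact Nat.le_add_right _ _, fun h => ?_⟩
  rw [key] at h
  have : k * (t - a) = 0 := by omega
  rcases Nat.mul_eq_zero.1 this with h | h <;> omega

theorem rhoBound_conditions {n a b : ℕ} (hn : 7 ≤ n) (hab : a + b = n) (hle : a ≤ b) :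
    ((a : ℝ) - 2) * ((b : ℝ) - 2) < rhoBound n ^ 2 ∧ 0 ≤ extPoly a b (rhoBound n ^ 2) ∧
      (extPoly a b (rhoBound n ^ 2) = 0 → a = n / 2 ∧ b = (n + 1) / 2) := by
  obtain ⟨-, h0, h4, -⟩ := rhoBound_facts (n := n) (by omega)
  have h4 := h4 hn
  rw [extPoly_add_eq (n := n) (by omega)] at h0
  rw [extPoly_add_eq hab]
  obtain ⟨hP, heq⟩ := mul_le_div_mul_div hab hle
  have hP' : ((a * b : ℕ) : ℝ) ≤ (n / 2 * ((n + 1) / 2) : ℕ) := by exact_mod_cast hP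
  have hn' : (7 : ℝ) ≤ n := by exact_mod_cast hn
  have hab' : (a : ℝ) + b = n := by exact_mod_cast hab
  generalize rhoBound n ^ 2 = l at *
  refine ⟨?_, ?_, fun h => ?_⟩
  -- By the equation for `l`, this product equals `2 * n - 13`, positive from `n = 7` on. So `l`
  -- exceeds the balanced product minus `n + 1`, while `(a - 2) * (b - 2) = a * b - 2 * n + 4`.
  · have : 0 < (l - 4) * (l - ((n / 2 * ((n + 1) / 2) : ℕ) - (n : ℝ) - 1)) := by
      nlinarith
    have := pos_of_mul_pos_right this (by linarith)
    push_cast at hP' this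
    nlinarith
  · nlinarith
  · have : (l - 4) * (((n / 2 * ((n + 1) / 2) : ℕ) : ℝ) - (a * b : ℕ)) = 0 := by linarith
    have := (mul_eq_zero.1 this).resolve_left (by linarith)
    have hE : (a * b : ℕ) = n / 2 * ((n + 1) / 2) := by
      have : ((n / 2 * ((n + 1) / 2) : ℕ) : ℝ) = (a * b : ℕ) := by linarith
      exact_mod_cast this.symm
    have := heq hE
    omega

end Bound

/-! ### Signed graphs in terms of adjacency matrices -/

section Graph

variable {V : Type*} (Γ : SignedGraph V)

theorem adjMatrix_of_adj {p q : V} (h : Γ.graph.Adj p q) :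
    Γ.adjMatrix p q = (((Γ.sign ⟨s(p, q), h⟩ : ℤˣ) : ℤ) : ℝ) := by
  simp [adjMatrix, h]

theorem adjMatrix_of_not_adj {p q : V} (h : ¬ Γ.graph.Adj p q) : Γ.adjMatrix p q = 0 := by
  simp [adjMatrix, h]

theorem adjMatrix_ne_zero_iff {p q : V} : Γ.adjMatrix p q ≠ 0 ↔ Γ.graph.Adj p q := by
  by_cases h : Γ.graph.Adj p q
  · rw [adjMatrix_of_adj Γ h]; simp [h]
  · rw [adjMatrix_of_not_adj Γ h]; simp [h]

theorem adjMatrix_mem (p q : V) :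
    Γ.adjMatrix p q = -1 ∨ Γ.adjMatrix p q = 0 ∨ Γ.adjMatrix p q = 1 := by
  by_cases h : Γ.graph.Adj p q
  · rw [adjMatrix_of_adj Γ h]
    rcases Int.units_eq_one_or (Γ.sign ⟨s(p, q), h⟩) with h' | h' <;> simp [h']
  · rw [adjMatrix_of_not_adj Γ h]; simp

theorem adjMatrix_symm (p q : V) : Γ.adjMatrix p q = Γ.adjMatrix q p := by
  by_cases h : Γ.graph.Adj p q
  · rw [adjMatrix_of_adj Γ h, adjMatrix_of_adj Γ h.symm]
    simp only [Sym2.eq_swap]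
  · rw [adjMatrix_of_not_adj Γ h, adjMatrix_of_not_adj Γ fun h' => h h'.symm]

theorem adjMatrix_self (p : V) : Γ.adjMatrix p p = 0 :=
  adjMatrix_of_not_adj Γ Γ.graph.irrefl

theorem isNegEdge_iff {p q : V} : Γ.IsNegEdge s(p, q) ↔ Γ.adjMatrix p q = -1 := by
  constructor
  · rintro ⟨h, h'⟩
    rw [adjMatrix_of_adj Γ h, h']; simp
  · intro h
    have hadj : Γ.graph.Adj p q := (adjMatrix_ne_zero_iff Γ).1 (by rw [h]; norm_num)
    refine ⟨hadj, ?_⟩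
    rw [adjMatrix_of_adj Γ hadj] at h
    rcases Int.units_eq_one_or (Γ.sign ⟨s(p, q), hadj⟩) with h' | h'
    · rw [h'] at h; norm_num at h
    · exact h'

open Classical in
theorem neg_one_pow_ite {p q : V} (h : Γ.graph.Adj p q) :
    (-1 : ℝ) ^ (if Γ.IsNegEdge s(p, q) then 1 else 0) = Γ.adjMatrix p q := by
  rw [isNegEdge_iff]
  rcases adjMatrix_mem Γ p q with h' | h' | h'
  · simp [h']
  · exact absurd h' ((adjMatrix_ne_zero_iff Γ).2 h)
  · rw [h']; norm_num

open Classical in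
-- Signs telescope along a walk when `θ` makes every edge positive. On a closed walk the product is
-- `1`, so no negative cycle exists; this is how unbalance enters.
theorem neg_one_pow_countP {θ : V → ℤˣ}
    (hθ : ∀ p q, Γ.graph.Adj p q → switchEntry Γ.adjMatrix θ p q = 1) {p q : V}
    (w : Γ.graph.Walk p q) :
    (-1 : ℝ) ^ (w.edges.countP fun e => Γ.IsNegEdge e) = ((θ p : ℤ) : ℝ) * ((θ q : ℤ) : ℝ) := by
  induction w with
  | nil => simp [unit_cast_sq]
  | @cons p r q h w ih =>
    rw [SimpleGraph.Walk.edges_cons, List.countP_cons, pow_add, ih]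
    have h1 := neg_one_pow_ite Γ h
    have h2 := hθ p r h
    unfold switchEntry at h2
    simp only [decide_eq_true_eq]
    rw [h1]
    have h3 := unit_cast_sq (θ p)
    have h4 := unit_cast_sq (θ r)
    linear_combination ((θ p : ℤ) : ℝ) * ((θ q : ℤ) : ℝ) * h2 -
      Γ.adjMatrix p r * ((θ r : ℤ) : ℝ) * ((θ q : ℤ) : ℝ) * h3

theorem Unbalanced.exists_neg {Γ : SignedGraph V} (h : Γ.Unbalanced) (θ : V → ℤˣ) :
    ∃ p q, switchEntry Γ.adjMatrix θ p q = -1 := by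
  classical
  by_contra hno
  push Not at hno
  obtain ⟨v, w, -, hodd⟩ := h
  have := neg_one_pow_countP Γ (θ := θ) (fun p q hpq => by
    rcases switchEntry_mem (adjMatrix_mem Γ) θ p q with h | h | h
    · exact absurd h (hno p q)
    · have := (adjMatrix_ne_zero_iff Γ).2 hpq
      unfold switchEntry at h
      simp at h
      exact absurd h this
    · exact h) w
  rw [unit_cast_sq, Odd.neg_one_pow (by convert hodd)] at this
  norm_num at this

theorem hasNegCycleOfLength_four {p q r t : V} (hpr : p ≠ r) (hqt : q ≠ t)
    (h : Γ.adjMatrix p q * Γ.adjMatrix q r * Γ.adjMatrix r t * Γ.adjMatrix t p < 0) :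
    Γ.HasNegCycleOfLength 4 := by
  classical
  have h1 : Γ.graph.Adj p q := (adjMatrix_ne_zero_iff Γ).1 fun h0 => by simp [h0] at h
  have h2 : Γ.graph.Adj q r := (adjMatrix_ne_zero_iff Γ).1 fun h0 => by simp [h0] at h
  have h3 : Γ.graph.Adj r t := (adjMatrix_ne_zero_iff Γ).1 fun h0 => by simp [h0] at h
  have h4 : Γ.graph.Adj t p := (adjMatrix_ne_zero_iff Γ).1 fun h0 => by simp [h0] at h
  refine ⟨p, .cons h1 (.cons h2 (.cons h3 (.cons h4 .nil))), ⟨?_, ?_⟩, rfl⟩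
  · rw [SimpleGraph.Walk.cons_isCycle_iff]
    simp [h2.ne, h3.ne, h4.ne, hqt, hpr.symm, h1.ne.symm, h1.ne, hpr, h4.ne.symm]
  · by_contra hodd
    have heven := (Nat.not_odd_iff_even.1 hodd).neg_one_pow (α := ℝ)
    simp only [SimpleGraph.Walk.edges_cons, SimpleGraph.Walk.edges_nil, List.countP_cons,
      List.countP_nil, zero_add, pow_add, decide_eq_true_eq, neg_one_pow_ite Γ h1,
      neg_one_pow_ite Γ h2, neg_one_pow_ite Γ h3, neg_one_pow_ite Γ h4] at heven
    linarith

theorem four_cycle_nonneg (hC4 : ¬ Γ.HasNegCycleOfLength 4) (p p' q q' : V) (hp : p ≠ p')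
    (hq : q ≠ q') :
    0 ≤ Γ.adjMatrix p q * Γ.adjMatrix p q' * Γ.adjMatrix p' q * Γ.adjMatrix p' q' := by
  by_contra h
  refine hC4 (hasNegCycleOfLength_four Γ hp hq ((le_of_eq ?_).trans_lt (not_le.1 h)))
  rw [adjMatrix_symm Γ q p', adjMatrix_symm Γ q' p]
  ring

open Classical in
theorem adjMatrix_switch (U : Set V) (p q : V) : (Γ.switch U).adjMatrix p q =
    switchEntry Γ.adjMatrix (fun v => if v ∈ U then -1 else 1) p q := by
  unfold switchEntry
  by_cases h : Γ.graph.Adj p q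
  · rw [adjMatrix_of_adj Γ h, adjMatrix_of_adj (Γ.switch U) h]
    have : (∃ u ∈ U, ∃ v ∉ U, s(p, q) = s(u, v)) ↔ ¬ (p ∈ U ↔ q ∈ U) := by
      constructor
      · rintro ⟨u, hu, v, hv, h⟩
        rcases Sym2.eq_iff.1 h with ⟨rfl, rfl⟩ | ⟨rfl, rfl⟩ <;> tauto
      · intro h
        by_cases hp : p ∈ U
        · exact ⟨p, hp, q, by tauto, rfl⟩
        · exact ⟨q, by tauto, p, hp, Sym2.eq_swap⟩
    simp only [switch, this]
    by_cases hp : p ∈ U <;> by_cases hq : q ∈ U <;> simp [hp, hq]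
  · rw [adjMatrix_of_not_adj Γ h, adjMatrix_of_not_adj (Γ.switch U) h, mul_zero]

theorem adjMatrix_of_isomorphic {W : Type*} {Γ : SignedGraph V} {Δ : SignedGraph W}
    (h : Γ.Isomorphic Δ) :
    ∃ e : V ≃ W, ∀ p q, Γ.adjMatrix p q = Δ.adjMatrix (e p) (e q) := by
  obtain ⟨φ, hφ⟩ := h
  refine ⟨φ.toEquiv, fun p q => ?_⟩
  by_cases h : Γ.graph.Adj p q
  · have h' : Δ.graph.Adj (φ p) (φ q) := φ.map_adj_iff.2 h
    rw [adjMatrix_of_adj Γ h]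
    refine Eq.trans ?_ (adjMatrix_of_adj Δ h').symm
    rw [← hφ]
    rfl
  · rw [adjMatrix_of_not_adj Γ h]
    exact (adjMatrix_of_not_adj Δ fun h' => h (φ.map_adj_iff.1 h')).symm

theorem isomorphic_of_adjMatrix {W : Type*} {Γ : SignedGraph V} {Δ : SignedGraph W} (e : V ≃ W)
    (h : ∀ p q, Γ.adjMatrix p q = Δ.adjMatrix (e p) (e q)) : Γ.Isomorphic Δ := by
  refine ⟨⟨e, fun {p q} => by rw [← adjMatrix_ne_zero_iff, ← h, adjMatrix_ne_zero_iff]⟩, ?_⟩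
  rintro ⟨e', he'⟩
  induction e' with
  | _ p q =>
    have hpq : Γ.graph.Adj p q := he'
    have hpq' : Δ.graph.Adj (e p) (e q) := by
      rw [← adjMatrix_ne_zero_iff, ← h, adjMatrix_ne_zero_iff]; exact hpq
    have := h p q
    rw [adjMatrix_of_adj Γ hpq, adjMatrix_of_adj Δ hpq'] at this
    have := Int.cast_injective this
    exact (Units.ext this).symm

theorem switchingIsomorphic_iff {W : Type*} {Γ : SignedGraph V} {Δ : SignedGraph W} :
    Γ.SwitchingIsomorphic Δ ↔ ∃ (e : V ≃ W) (θ : V → ℤˣ),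
      ∀ p q, switchEntry Γ.adjMatrix θ p q = Δ.adjMatrix (e p) (e q) := by
  classical
  have hcancel : ∀ (A : V → V → ℝ) (θ : V → ℤˣ) (p q : V),
      switchEntry (switchEntry A θ) θ p q = A p q := by
    intro A θ p q
    unfold switchEntry
    linear_combination A p q * unit_cast_sq (θ p) * ((θ q : ℤ) : ℝ) ^ 2 +
      A p q * unit_cast_sq (θ q)
  constructor
  · rintro ⟨Δ', ⟨U, rfl⟩, hiso⟩
    obtain ⟨e, he⟩ := adjMatrix_of_isomorphic hiso
    refine ⟨e, fun v => if e v ∈ U then -1 else 1, fun p q => ?_⟩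
    rw [← hcancel (fun p q => Δ.adjMatrix (e p) (e q)) (fun v => if e v ∈ U then -1 else 1) p q]
    unfold switchEntry
    rw [he, adjMatrix_switch]
    rfl
  · rintro ⟨e, θ, h⟩
    refine ⟨Δ.switch {y | θ (e.symm y) = -1}, ⟨_, rfl⟩, isomorphic_of_adjMatrix e fun p q => ?_⟩
    rw [adjMatrix_switch, ← hcancel Γ.adjMatrix θ p q]
    have hθ : ∀ (p) [Decidable (e p ∈ {y | θ (e.symm y) = -1})],
        (if e p ∈ {y | θ (e.symm y) = -1} then -1 else 1 : ℤˣ) = θ p := by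
      intro p _
      rcases Int.units_eq_one_or (θ p) with h | h <;> simp [h]
    unfold switchEntry
    beta_reduce
    rw [hθ, hθ, ← h p q]
    rfl

end Graph

/-! ### The spectral radius as a maximum over eigenvalues -/

section Rho

variable {V : Type*} [Fintype V] [DecidableEq V]

theorem mem_spectrum_iff (A : Matrix V V ℝ) (μ : ℝ) :
    μ ∈ spectrum ℝ A ↔ ∃ x : V → ℝ, x ≠ 0 ∧ ∀ p, ∑ q, A p q * x q = μ * x p := by
  rw [← Matrix.spectrum_toLin', ← Module.End.hasEigenvalue_iff_mem_spectrum]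
  constructor
  · intro h
    obtain ⟨x, hx⟩ := h.exists_hasEigenvector
    refine ⟨x, hx.2, fun p => ?_⟩
    have := congrFun hx.apply_eq_smul p
    simpa [Matrix.toLin'_apply, Matrix.mulVec, dotProduct] using this
  · rintro ⟨x, hx0, hx⟩
    refine Module.End.hasEigenvalue_of_hasEigenvector (x := x) ⟨?_, hx0⟩
    rw [Module.End.mem_eigenspace_iff]
    funext p
    simpa [Matrix.toLin'_apply, Matrix.mulVec, dotProduct] using hx p

theorem rho_eq_of_forall_le {Γ : SignedGraph V} {μ : ℝ} (hμ : μ ∈ spectrum ℝ Γ.adjMatrix)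
    (h : ∀ k ∈ spectrum ℝ Γ.adjMatrix, |k| ≤ |μ|) : Γ.rho = |μ| := by
  have : spectralRadius ℝ Γ.adjMatrix = (‖μ‖₊ : ENNReal) := by
    refine le_antisymm (iSup₂_le fun k hk => ?_) (le_iSup₂ (f := fun k _ => (‖k‖₊ : ENNReal)) μ hμ)
    exact_mod_cast h k hk
  rw [rho, this]
  simp

theorem exists_eigenvalue_rho [Nonempty V] (Γ : SignedGraph V) :
    ∃ μ ∈ spectrum ℝ Γ.adjMatrix, Γ.rho = |μ| := by
  have hH : Γ.adjMatrix.IsHermitian := by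
    ext p q
    simpa using adjMatrix_symm Γ q p
  obtain ⟨μ, hμ, hmax⟩ := Set.exists_max_image (spectrum ℝ Γ.adjMatrix) (fun k => |k|)
    (Matrix.finite_real_spectrum) ⟨_, hH.eigenvalues_mem_spectrum_real (Classical.arbitrary V)⟩
  exact ⟨μ, hμ, rho_eq_of_forall_le hμ hmax⟩

end Rho

/-! ### The extremal graph attains the bound -/

section Extremal

theorem extremal_inl_inr {r t : ℕ} (hr : 2 ≤ r) (ht : 2 ≤ t) (i : Fin r) (j : Fin t) :
    (extremal r t).adjMatrix (.inl i) (.inr j) =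
      pathBlock (⟨0, by omega⟩ : Fin r) ⟨1, by omega⟩ (⟨0, by omega⟩ : Fin t) ⟨1, by omega⟩ i j := by
  have hsign : (∃ (i' : Fin r) (j' : Fin t), i'.val = 0 ∧ j'.val = 0 ∧
      s((.inl i : Fin r ⊕ Fin t), .inr j) = s(.inl i', .inr j')) ↔ i.val = 0 ∧ j.val = 0 := by
    constructor
    · rintro ⟨i', j', hi, hj, h⟩
      simp only [Sym2.eq_iff, Sum.inl.injEq, Sum.inr.injEq, reduceCtorEq, and_self, or_false] at h
      rw [h.1, h.2]
      exact ⟨hi, hj⟩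
    · rintro ⟨hi, hj⟩
      exact ⟨i, j, hi, hj, rfl⟩
  have hadj : (extremal r t).graph.Adj (.inl i) (.inr j) ↔ extremalRel i j := Iff.rfl
  by_cases h : extremalRel i j
  · rw [adjMatrix_of_adj _ (hadj.2 h)]
    simp only [extremal, hsign]
    unfold extremalRel at h
    unfold pathBlock offInd diffInd
    simp only [Fin.ext_iff]
    by_cases h1 : i.val = 0 <;> by_cases h2 : j.val = 0 <;> by_cases h3 : i.val = 1 <;>
      by_cases h4 : j.val = 1 <;> simp [h1, h2, h3, h4] <;> omega
  · rw [adjMatrix_of_not_adj _ (fun h' => h (hadj.1 h'))]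
    unfold extremalRel at h
    unfold pathBlock offInd diffInd
    simp only [Fin.ext_iff]
    by_cases h1 : i.val = 0 <;> by_cases h2 : j.val = 0 <;> by_cases h3 : i.val = 1 <;>
      by_cases h4 : j.val = 1 <;> simp [h1, h2, h3, h4] <;> omega

theorem extremal_inl_inl {r t : ℕ} (i i' : Fin r) :
    (extremal r t).adjMatrix (.inl i) (.inl i') = 0 := adjMatrix_of_not_adj _ id

theorem extremal_inr_inr {r t : ℕ} (j j' : Fin t) :
    (extremal r t).adjMatrix (.inr j) (.inr j') = 0 := adjMatrix_of_not_adj _ id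

theorem switchingIsomorphic_extremal {V : Type*} {Γ : SignedGraph V} {r t : ℕ} (hr : 2 ≤ r)
    (ht : 2 ≤ t) (f : Fin r ⊕ Fin t ≃ V) (θ : V → ℤˣ)
    (h1 : ∀ i i', Γ.adjMatrix (f (.inl i)) (f (.inl i')) = 0)
    (h2 : ∀ j j', Γ.adjMatrix (f (.inr j)) (f (.inr j')) = 0)
    (h : ∀ i j, switchEntry Γ.adjMatrix θ (f (.inl i)) (f (.inr j)) =
      pathBlock (⟨0, by omega⟩ : Fin r) ⟨1, by omega⟩ (⟨0, by omega⟩ : Fin t) ⟨1, by omega⟩ i j) :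
    Γ.SwitchingIsomorphic (extremal r t) := by
  refine switchingIsomorphic_iff.2 ⟨f.symm, θ, fun p q => ?_⟩
  obtain ⟨a, rfl⟩ := f.surjective p
  obtain ⟨b, rfl⟩ := f.surjective q
  rw [f.symm_apply_apply, f.symm_apply_apply]
  rcases a with i | j <;> rcases b with i' | j'
  · rw [extremal_inl_inl]; unfold switchEntry; rw [h1, mul_zero]
  · rw [extremal_inl_inr hr ht, h]
  · rw [adjMatrix_symm (extremal r t), extremal_inl_inr hr ht, ← h]
    unfold switchEntry
    rw [adjMatrix_symm Γ (f (.inr j))]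
    ring
  · rw [extremal_inr_inr]; unfold switchEntry; rw [h2, mul_zero]

theorem exists_equiv_fin {X : Type*} [Fintype X] {r : ℕ} (hr : 2 ≤ r)
    (hX : Fintype.card X = r) {u z : X} (huz : u ≠ z) :
    ∃ e : X ≃ Fin r, e u = ⟨0, by omega⟩ ∧ e z = ⟨1, by omega⟩ := by
  classical
  obtain ⟨e₁, h₁⟩ : ∃ e : X ≃ Fin r, e u = ⟨0, by omega⟩ :=
    ⟨(Fintype.equivFinOfCardEq hX).trans
      (Equiv.swap (Fintype.equivFinOfCardEq hX u) ⟨0, by omega⟩), by simp⟩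
  refine ⟨e₁.trans (Equiv.swap (e₁ z) ⟨1, by omega⟩), ?_, by simp⟩
  rw [Equiv.trans_apply, h₁]
  refine Equiv.swap_apply_of_ne_of_ne ?_ (by simp)
  rw [← h₁]
  exact e₁.injective.ne huz

theorem pathBlock_symm_apply {X Y X' Y' : Type*} [DecidableEq X] [DecidableEq Y] [DecidableEq X']
    [DecidableEq Y'] (e : X ≃ X') (f : Y ≃ Y') (u z : X) (v w : Y) (i : X') (j : Y') :
    pathBlock u z v w (e.symm i) (f.symm j) = pathBlock (e u) (e z) (f v) (f w) i j := by
  simp only [pathBlock, offInd, diffInd, Equiv.symm_apply_eq]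

theorem switchingIsomorphic_of_eq_pathBlock {V : Type*} [Fintype V] [DecidableEq V]
    {Γ : SignedGraph V} (s : V → Prop) [DecidablePred s]
    (hs : ∀ p q, Γ.adjMatrix p q ≠ 0 → (s p ↔ ¬ s q)) {r t : ℕ} (hr : 2 ≤ r) (ht : 2 ≤ t)
    (hX : Fintype.card {p // s p} = r) (hY : Fintype.card {p // ¬ s p} = t) (θ : V → ℤˣ)
    {u z : {p // s p}} {v w : {p // ¬ s p}} (huz : u ≠ z) (hvw : v ≠ w)
    (h : ∀ (i : {p // s p}) (j : {p // ¬ s p}),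
      switchEntry Γ.adjMatrix θ i j = pathBlock u z v w i j) :
    Γ.SwitchingIsomorphic (extremal r t) := by
  obtain ⟨e, hu, hz⟩ := exists_equiv_fin hr hX huz
  obtain ⟨f, hv, hw⟩ := exists_equiv_fin ht hY hvw
  refine switchingIsomorphic_extremal hr ht ((Equiv.sumCongr e f).symm.trans (Equiv.sumCompl s)) θ
    (fun i i' => ?_) (fun j j' => ?_) (fun i j => ?_)
  · by_contra h0
    exact (hs _ _ h0).1 (e.symm i).2 (e.symm i').2
  · by_contra h0
    exact (f.symm j).2 ((hs _ _ h0).2 (f.symm j').2)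
  · rw [← hu, ← hz, ← hv, ← hw, ← pathBlock_symm_apply, ← h]
    rfl

theorem form_le_of_rhoBound {n : ℕ} (hn : 6 ≤ n) (S D : ℝ) :
    (2 * ((n / 2 : ℕ) : ℝ) - 3) * (((((n + 1) / 2 : ℕ) : ℝ) - 1) * S ^ 2 - 2 * S * D + 2 * D ^ 2) ≤
      rhoBound n ^ 2 * (2 * S ^ 2 - 2 * S * D + (((n / 2 : ℕ) : ℝ) - 1) * D ^ 2) ∧
    (2 * (((n + 1) / 2 : ℕ) : ℝ) - 3) * ((((n / 2 : ℕ) : ℝ) - 1) * S ^ 2 - 2 * S * D + 2 * D ^ 2) ≤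
      rhoBound n ^ 2 * (2 * S ^ 2 - 2 * S * D + ((((n + 1) / 2 : ℕ) : ℝ) - 1) * D ^ 2) := by
  obtain ⟨-, h0, h7, h6⟩ := rhoBound_facts hn
  by_cases hn7 : 7 ≤ n
  · have h2 : (2 : ℝ) ≤ (n / 2 : ℕ) := by exact_mod_cast (by omega : 2 ≤ n / 2)
    have h2' : (2 : ℝ) ≤ ((n + 1) / 2 : ℕ) := by exact_mod_cast (by omega : 2 ≤ (n + 1) / 2)
    refine ⟨form_le h2 (h7 hn7) h0.ge S D, form_le h2' (h7 hn7) (Eq.ge ?_) S D⟩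
    rw [← h0]; unfold extPoly; ring
  · have : n = 6 := by omega
    subst this
    rw [h6 rfl]
    norm_num

theorem sum_offInd_mul_sub {Z : Type*} [Fintype Z] [DecidableEq Z] {p k : Z} (hpk : p ≠ k)
    (x y : ℝ) : ∑ i, offInd p i * (offInd p i * x - diffInd k p i * y) =
      ((Fintype.card Z : ℝ) - 1) * x - y := by
  rw [← sum_offInd_sq p]
  calc _ = (∑ i, offInd p i ^ 2) * x - (∑ i, offInd p i * diffInd k p i) * y := by
        rw [sum_mul, sum_mul, ← sum_sub_distrib]
        exact sum_congr rfl fun i _ => by ring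
    _ = _ := by rw [sum_offInd_mul_diffInd hpk, one_mul]

/-- The hypotheses are the eigenvector equations of the Gram operator of the block on the span of
`offInd v` and `diffInd w v`, in the coordinates `(S, -D)`. -/
theorem exists_singular_vector {X Y : Type*} [Fintype X] [Fintype Y] [DecidableEq X]
    [DecidableEq Y] {u z : X} (huz : u ≠ z) {v w : Y} (hvw : v ≠ w) {B S D : ℝ} (hB : B ≠ 0)
    (h1 : B ^ 2 * S = (((Fintype.card X : ℝ) - 1) * ((Fintype.card Y : ℝ) - 1) - 1) * S -
      ((Fintype.card X : ℝ) - 3) * D)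
    (h2 : B ^ 2 * D = ((Fintype.card Y : ℝ) - 3) * S + 3 * D) (hSD : S ≠ 0 ∨ D ≠ 0) :
    ∃ (ξ : X → ℝ) (η : Y → ℝ), η ≠ 0 ∧ (∀ i, ∑ j, pathBlock u z v w i j * η j = B * ξ i) ∧
      ∀ j, ∑ i, pathBlock u z v w i j * ξ i = B * η j := by
  set η : Y → ℝ := fun j => offInd v j * S - diffInd w v j * D with hη
  have hηv : η v = D := by
    simp only [hη]; rw [offInd_self, diffInd_right hvw]; ring
  have hηw : η w = S - D := by
    simp only [hη]; rw [offInd_of_ne hvw.symm, diffInd_left hvw.symm]; ring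
  have hT : ∑ j, offInd v j * η j = ((Fintype.card Y : ℝ) - 1) * S - D := sum_offInd_mul_sub hvw S D
  set T : ℝ := ((Fintype.card Y : ℝ) - 1) * S - D
  set E : ℝ := S - 2 * D with hE
  set ξ : X → ℝ := fun i => B⁻¹ * (offInd u i * T - diffInd z u i * E) with hξ
  have hξu : ξ u = B⁻¹ * E := by
    simp only [hξ]; rw [offInd_self, diffInd_right huz]; ring
  have hξz : ξ z = B⁻¹ * (T - E) := by
    simp only [hξ]; rw [offInd_of_ne huz.symm, diffInd_left huz.symm]; ring
  have hS : ∑ i, offInd u i * ξ i = B⁻¹ * (((Fintype.card X : ℝ) - 1) * T - E) := by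
    rw [← sum_offInd_mul_sub huz T E, mul_sum]
    exact sum_congr rfl fun i _ => by simp only [hξ]; ring
  refine ⟨ξ, η, fun h0 => ?_, fun i => ?_, fun j => ?_⟩
  · rw [h0] at hηv hηw
    simp only [Pi.zero_apply] at hηv hηw
    rcases hSD with h | h
    · exact h (by linarith)
    · exact h hηv.symm
  · simp_rw [← pathBlock_swap u z v w]
    rw [sum_pathBlock_mul, sum_diffInd_mul, hT, hηv, hηw]
    simp only [hξ]
    rw [mul_inv_cancel_left₀ hB, hE]
    ring
  · rw [sum_pathBlock_mul, sum_diffInd_mul, hS, hξu, hξz]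
    have e1 : ((Fintype.card X : ℝ) - 1) * T - E = B ^ 2 * S := by
      rw [h1, hE]; simp only [T]; ring
    have e2 : T - E - E = B ^ 2 * D := by
      rw [h2, hE]; simp only [T]; ring
    rw [e1, ← mul_sub, e2, pow_two, mul_assoc, mul_assoc, inv_mul_cancel_left₀ hB,
      inv_mul_cancel_left₀ hB]
    simp only [hη]
    ring

theorem rho_extremal {n : ℕ} (hn : 6 ≤ n) :
    (extremal (n / 2) ((n + 1) / 2)).rho = rhoBound n := by
  obtain ⟨hB, h0, h7, h6⟩ := rhoBound_facts hn
  have hform := form_le_of_rhoBound hn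
  have hr : 3 ≤ n / 2 := by omega
  have ht : 3 ≤ (n + 1) / 2 := by omega
  have hSD : ∃ S D : ℝ, rhoBound n ^ 2 * S = ((((n / 2 : ℕ) : ℝ) - 1) *
      ((((n + 1) / 2 : ℕ) : ℝ) - 1) - 1) * S - (((n / 2 : ℕ) : ℝ) - 3) * D ∧
      rhoBound n ^ 2 * D = ((((n + 1) / 2 : ℕ) : ℝ) - 3) * S + 3 * D ∧ (S ≠ 0 ∨ D ≠ 0) := by
    by_cases hn7 : 7 ≤ n
    -- The pair solves the second equation identically, and the first becomes `extPoly = 0`. For `n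
    -- = 6` it degenerates to zero, but then the two-dimensional operator is `3` times the identity
    -- and any nonzero pair serves.
    · refine ⟨rhoBound n ^ 2 - 3, (((n + 1) / 2 : ℕ) : ℝ) - 3, ?_, by ring,
        Or.inl (by linarith [h7 hn7])⟩
      unfold extPoly at h0
      linear_combination h0
    · have : n = 6 := by omega
      subst this
      refine ⟨1, 0, ?_, ?_, Or.inl one_ne_zero⟩ <;> norm_num [h6 rfl]
  generalize n / 2 = r at *
  generalize (n + 1) / 2 = t at *
  set B := rhoBound n
  have hu : (⟨0, by omega⟩ : Fin r) ≠ ⟨1, by omega⟩ := by simp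
  have hv : (⟨0, by omega⟩ : Fin t) ≠ ⟨1, by omega⟩ := by simp
  have hrow : ∀ (x : Fin r ⊕ Fin t → ℝ) (i : Fin r),
      ∑ q, (extremal r t).adjMatrix (.inl i) q * x q = ∑ j, pathBlock (⟨0, by omega⟩ : Fin r)
        ⟨1, by omega⟩ (⟨0, by omega⟩ : Fin t) ⟨1, by omega⟩ i j * x (.inr j) := by
    intro x i
    simp [Fintype.sum_sum_type, extremal_inl_inl, extremal_inl_inr (by omega : 2 ≤ r)
      (by omega : 2 ≤ t)]
  have hcol : ∀ (x : Fin r ⊕ Fin t → ℝ) (j : Fin t),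
      ∑ q, (extremal r t).adjMatrix (.inr j) q * x q = ∑ i, pathBlock (⟨0, by omega⟩ : Fin r)
        ⟨1, by omega⟩ (⟨0, by omega⟩ : Fin t) ⟨1, by omega⟩ i j * x (.inl i) := by
    intro x j
    simp [Fintype.sum_sum_type, extremal_inr_inr, adjMatrix_symm (extremal r t) (.inr j),
      extremal_inl_inr (by omega : 2 ≤ r) (by omega : 2 ≤ t)]
  have hmem : B ∈ spectrum ℝ (extremal r t).adjMatrix := by
    obtain ⟨S, D, e1, e2, hne⟩ := hSD
    obtain ⟨ξ, η, hη, k1, k2⟩ := exists_singular_vector hu hv hB.ne' (by simpa using e1)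
      (by simpa using e2) hne
    refine (mem_spectrum_iff _ _).2 ⟨Sum.elim ξ η, fun h => hη (funext fun j => congrFun h (.inr j)),
      ?_⟩
    rintro (i | j)
    · rw [hrow]; exact k1 i
    · rw [hcol]; exact k2 j
  rw [rho_eq_of_forall_le hmem fun k hk => ?_, abs_of_pos hB]
  obtain ⟨x, hx0, hx⟩ := (mem_spectrum_iff _ _).1 hk
  rw [abs_of_pos hB]
  refine abs_le_of_sq_le_sq ?_ hB.le
  have a1 := sum_sq_pathBlock_le hu hv (sq_nonneg B) (by simpa using fun S D => (hform S D).1)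
    (fun i => x (.inl i))
  have a2 := sum_sq_pathBlock_le hv hu (sq_nonneg B) (by simpa using fun S D => (hform S D).2)
    (fun j => x (.inr j))
  simp_rw [← hcol x, hx, mul_pow, ← mul_sum] at a1
  simp_rw [pathBlock_swap (⟨0, by omega⟩ : Fin r) ⟨1, by omega⟩ (⟨0, by omega⟩ : Fin t)
    ⟨1, by omega⟩, ← hrow x, hx, mul_pow, ← mul_sum] at a2
  have hpos : 0 < ∑ q, x q ^ 2 := by
    obtain ⟨q, hq⟩ := Function.ne_iff.1 hx0
    have : x q ≠ 0 := hq
    exact sum_pos' (fun _ _ => sq_nonneg _) ⟨q, mem_univ q, by positivity⟩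
  rw [Fintype.sum_sum_type] at hpos
  refine le_of_mul_le_mul_right ?_ hpos
  linarith

theorem SwitchingIsomorphic.rho_eq {V W : Type*} [Fintype V] [Fintype W] [DecidableEq V]
    [DecidableEq W] {Γ : SignedGraph V} {Δ : SignedGraph W} (h : Γ.SwitchingIsomorphic Δ) :
    Γ.rho = Δ.rho := by
  obtain ⟨e, θ, h⟩ := switchingIsomorphic_iff.1 h
  have : spectrum ℝ Γ.adjMatrix = spectrum ℝ Δ.adjMatrix := by
    ext k
    rw [mem_spectrum_iff, mem_spectrum_iff]
    constructor
    · rintro ⟨x, hx0, hx⟩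
      refine ⟨fun y => ((θ (e.symm y) : ℤ) : ℝ) * x (e.symm y), fun h0 => hx0 ?_, fun y => ?_⟩
      · funext p
        have := congrFun h0 (e p)
        simpa using this
      · obtain ⟨p, rfl⟩ := e.surjective y
        rw [← e.sum_comp]
        simp only [e.symm_apply_apply, ← h]
        rw [mul_left_comm, ← hx p, mul_sum]
        refine sum_congr rfl fun q _ => ?_
        unfold switchEntry
        linear_combination (((θ p : ℤ) : ℝ) * Γ.adjMatrix p q * x q) * unit_cast_sq (θ q)
    · rintro ⟨y, hy0, hy⟩
      refine ⟨fun p => ((θ p : ℤ) : ℝ) * y (e p), fun h0 => hy0 ?_, fun p => ?_⟩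
      · funext q
        have := congrFun h0 (e.symm q)
        simpa using this
      · rw [mul_left_comm, ← hy (e p), mul_sum, ← e.sum_comp]
        refine sum_congr rfl fun q _ => ?_
        rw [← h]
        unfold switchEntry
        linear_combination (-((θ q : ℤ) : ℝ) * Γ.adjMatrix p q * y (e q)) * unit_cast_sq (θ p)
  unfold rho spectralRadius
  rw [this]

end Extremal

/-! ### The upper bound, and the hexagon case of order six -/

section Main

variable {V : Type*}

theorem exists_bipartition {G : SimpleGraph V} (h : G.IsBipartite) :
    ∃ s : V → Prop, (∀ p q, G.Adj p q → (s p ↔ ¬ s q)) ∧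
      Nat.card {p // s p} ≤ Nat.card {p // ¬ s p} := by
  obtain ⟨c⟩ := h
  have hc : ∀ p q, G.Adj p q → (c p = 0 ↔ ¬ c q = 0) := fun p q hpq => by
    have := c.valid hpq
    generalize c p = a at *
    generalize c q = b at *
    revert a b
    decide
  -- The smaller class is named `s`, to match the order of the parts of `extremal (n / 2) ((n + 1) /
  -- 2)`.
  rcases le_total (Nat.card {p // c p = 0}) (Nat.card {p // ¬ c p = 0}) with hle | hle
  · exact ⟨fun p => c p = 0, hc, hle⟩
  · refine ⟨fun p => ¬ c p = 0, fun p q hpq => not_congr (hc p q hpq), ?_⟩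
    simpa only [not_not] using hle

theorem exists_pos_eigenvector [Fintype V] {A : V → V → ℝ} {s : V → Prop}
    (hs : ∀ p q, A p q ≠ 0 → (s p ↔ ¬ s q)) {x : V → ℝ} (hx0 : x ≠ 0) {μ : ℝ} (hμ : μ ≠ 0)
    (hx : ∀ p, ∑ q, A p q * x q = μ * x p) :
    ∃ y : V → ℝ, y ≠ 0 ∧ ∀ p, ∑ q, A p q * y q = |μ| * y p := by
  classical
  rcases hμ.lt_or_gt with hneg | hpos
  · refine ⟨fun p => if s p then x p else -x p, fun h => hx0 (funext fun p => ?_), fun p => ?_⟩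
    · have := congrFun h p
      by_cases hp : s p <;> simpa [hp] using this
    · have : ∀ q, A p q * (if s q then x q else -x q) =
          (if s p then -1 else 1) * (A p q * x q) := by
        intro q
        by_cases h0 : A p q = 0
        · simp [h0]
        · have := hs p q h0
          by_cases hp : s p
          · simp [hp, this.1 hp]
          · have hq : s q := by tauto
            simp [hp, hq]
      simp_rw [this]
      rw [← mul_sum, hx, abs_of_neg hneg]
      split_ifs <;> ring
  · exact ⟨x, hx0, by rwa [abs_of_pos hpos]⟩

/-- A long chord cuts the hexagon into two 4-cycles that share only the chord. The product of their
signs is the sign of the hexagon, so one of them would be negative. -/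
theorem chord_eq_zero {Γ : SignedGraph V} (hC4 : ¬ Γ.HasNegCycleOfLength 4) {p q r t x y : V}
    (hpr : p ≠ r) (hqt : q ≠ t) (hpx : p ≠ x) (hty : t ≠ y)
    (h : Γ.adjMatrix p q * Γ.adjMatrix q r * Γ.adjMatrix r t * Γ.adjMatrix t x *
      Γ.adjMatrix x y * Γ.adjMatrix y p = -1) : Γ.adjMatrix p t = 0 := by
  have h1 := four_cycle_nonneg Γ hC4 p r q t hpr hqt
  have h2 := four_cycle_nonneg Γ hC4 p x t y hpx hty
  rw [adjMatrix_symm Γ r q] at h1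
  rw [adjMatrix_symm Γ p y, adjMatrix_symm Γ x t] at h2
  have h3 := mul_nonneg h1 h2
  have h4 : Γ.adjMatrix p t ^ 2 ≤ 0 := by
    have : Γ.adjMatrix p q * Γ.adjMatrix p t * Γ.adjMatrix q r * Γ.adjMatrix r t *
        (Γ.adjMatrix p t * Γ.adjMatrix y p * Γ.adjMatrix t x * Γ.adjMatrix x y) =
        -Γ.adjMatrix p t ^ 2 := by linear_combination Γ.adjMatrix p t ^ 2 * h
    linarith
  exact pow_eq_zero_iff two_ne_zero |>.1 (le_antisymm h4 (sq_nonneg _))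

theorem switchEntry_of_adj {Γ : SignedGraph V} {p q : V} {ε : ℤˣ}
    (h : Γ.adjMatrix p q = ((ε : ℤ) : ℝ)) (θ : V → ℤˣ) :
    switchEntry Γ.adjMatrix θ p q = ((θ p * θ q * ε : ℤˣ) : ℤ) := by
  unfold switchEntry
  rw [h]
  push_cast
  ring

variable [Fintype V]

theorem rho_le_of_seven_le [DecidableEq V] {Γ : SignedGraph V} {n : ℕ} (hcard : Fintype.card V = n) (hn : 7 ≤ n)
    (hbip : Γ.graph.IsBipartite) (hunb : Γ.Unbalanced) (hC4 : ¬ Γ.HasNegCycleOfLength 4) :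
    Γ.rho ≤ rhoBound n ∧
      (Γ.rho = rhoBound n → Γ.SwitchingIsomorphic (extremal (n / 2) ((n + 1) / 2))) := by
  classical
  obtain ⟨hB, -, hB4, -⟩ := rhoBound_facts (n := n) (by omega)
  obtain ⟨s, hs, hle⟩ := exists_bipartition hbip
  have hs' : ∀ p q, Γ.adjMatrix p q ≠ 0 → (s p ↔ ¬ s q) := fun p q h =>
    hs p q ((adjMatrix_ne_zero_iff Γ).1 h)
  rw [Nat.card_eq_fintype_card, Nat.card_eq_fintype_card] at hle
  have hab : Fintype.card {p // s p} + Fintype.card {p // ¬ s p} = n := by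
    rw [← Fintype.card_sum, Fintype.card_congr (Equiv.sumCompl s), hcard]
  have : Nonempty V := Fintype.card_pos_iff.1 (by omega)
  obtain ⟨μ, hμ, hrho⟩ := exists_eigenvalue_rho Γ
  rw [hrho]
  by_cases hμ0 : μ = 0
  · rw [hμ0, abs_zero]
    exact ⟨hB.le, fun h => absurd h hB.ne⟩
  obtain ⟨x, hx0, hx⟩ := (mem_spectrum_iff _ _).1 hμ
  obtain ⟨y, hy0, hy⟩ := exists_pos_eigenvector hs' hx0 hμ0 hx
  obtain ⟨hsmall, hpoly, heq0⟩ := rhoBound_conditions hn hab hle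
  obtain ⟨hmain, heq⟩ := eigenvalue_le (adjMatrix_mem Γ) (adjMatrix_symm Γ) (adjMatrix_self Γ)
    hunb.exists_neg (four_cycle_nonneg Γ hC4) s hs' hy0 (abs_pos.2 hμ0) hy rfl rfl hB (hB4 hn)
    hsmall hpoly
  refine ⟨hmain, fun h => ?_⟩
  obtain ⟨h0, hex⟩ := heq h
  obtain ⟨ha, hb⟩ := heq0 h0
  obtain ⟨θ, u, z, v, w, huz, hvw, hM⟩ := hex (by omega) (by omega)
  exact switchingIsomorphic_of_eq_pathBlock s hs' (by omega) (by omega) ha hb θ huz hvw hM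

theorem units_mul_mul_mul (a b : ℤˣ) : a * (a * b) * b = 1 ∧ a * b * a * b = 1 := by
  revert a b; decide

theorem switchingIsomorphic_of_hexagon {Γ : SignedGraph V} (hcard : Fintype.card V = 6)
    {s : V → Prop} (hs : ∀ p q, Γ.graph.Adj p q → (s p ↔ ¬ s q))
    (hC4 : ¬ Γ.HasNegCycleOfLength 4) {v0 v1 v2 v3 v4 v5 : V}
    (hprod : Γ.adjMatrix v5 v0 * Γ.adjMatrix v4 v5 * Γ.adjMatrix v3 v4 * Γ.adjMatrix v2 v3 *
      Γ.adjMatrix v1 v2 * Γ.adjMatrix v0 v1 = -1)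
    (e0 : Γ.graph.Adj v0 v1) (e1 : Γ.graph.Adj v1 v2) (e2 : Γ.graph.Adj v2 v3)
    (e3 : Γ.graph.Adj v3 v4) (e4 : Γ.graph.Adj v4 v5) (e5 : Γ.graph.Adj v5 v0)
    (n02 : v0 ≠ v2) (n03 : v0 ≠ v3) (n04 : v0 ≠ v4) (n13 : v1 ≠ v3) (n14 : v1 ≠ v4)
    (n15 : v1 ≠ v5) (n24 : v2 ≠ v4) (n25 : v2 ≠ v5) (n35 : v3 ≠ v5) :
    Γ.SwitchingIsomorphic (extremal 3 3) := by
  have hpar : ∀ {p q r}, Γ.graph.Adj p q → Γ.graph.Adj q r → (s r ↔ s p) := by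
    intro p q r h h'
    rw [hs p q h, hs q r h', not_not]
  have hzero : ∀ p q, (s p ↔ s q) → Γ.adjMatrix p q = 0 := fun p q hpq => by
    by_contra h
    have := hs p q ((adjMatrix_ne_zero_iff Γ).1 h)
    rw [hpq] at this
    exact iff_not_self this
  have c03 : Γ.adjMatrix v0 v3 = 0 := chord_eq_zero hC4 n02 n13 n04 n35
    (q := v1) (r := v2) (x := v4) (y := v5) (by linarith)
  have c41 : Γ.adjMatrix v4 v1 = 0 := by
    rw [adjMatrix_symm]
    exact chord_eq_zero hC4 n13 n24 n15 (Ne.symm n04) (q := v2) (r := v3) (x := v5) (y := v0) (by linarith)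
  have c25 : Γ.adjMatrix v2 v5 = 0 := chord_eq_zero hC4 n24 n35 (Ne.symm n02) (Ne.symm n15)
    (q := v3) (r := v4) (x := v0) (y := v1) (by linarith)
  obtain ⟨ε0, a0⟩ : ∃ ε : ℤˣ, Γ.adjMatrix v0 v1 = ((ε : ℤ) : ℝ) := ⟨_, adjMatrix_of_adj Γ e0⟩
  obtain ⟨ε1, a1⟩ : ∃ ε : ℤˣ, Γ.adjMatrix v1 v2 = ((ε : ℤ) : ℝ) := ⟨_, adjMatrix_of_adj Γ e1⟩
  obtain ⟨ε2, a2⟩ : ∃ ε : ℤˣ, Γ.adjMatrix v2 v3 = ((ε : ℤ) : ℝ) := ⟨_, adjMatrix_of_adj Γ e2⟩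
  obtain ⟨ε3, a3⟩ : ∃ ε : ℤˣ, Γ.adjMatrix v3 v4 = ((ε : ℤ) : ℝ) := ⟨_, adjMatrix_of_adj Γ e3⟩
  obtain ⟨ε4, a4⟩ : ∃ ε : ℤˣ, Γ.adjMatrix v4 v5 = ((ε : ℤ) : ℝ) := ⟨_, adjMatrix_of_adj Γ e4⟩
  obtain ⟨ε5, a5⟩ : ∃ ε : ℤˣ, Γ.adjMatrix v5 v0 = ((ε : ℤ) : ℝ) := ⟨_, adjMatrix_of_adj Γ e5⟩
  have hε : ε5 * ε4 * ε3 * ε2 * ε1 * ε0 = -1 := by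
    rw [a0, a1, a2, a3, a4, a5] at hprod
    refine Units.ext (Int.cast_injective (α := ℝ) ?_)
    push_cast
    linarith
  rw [adjMatrix_symm] at a1 a3 a5
  -- Index `0` on each side goes to the future negative edge `v0 v1`, and index `1` to the opposite
  -- pair `v2`, `v5`, which plays the deleted edge.
  let f : Fin 3 ⊕ Fin 3 → V := Sum.elim ![v0, v2, v4] ![v1, v5, v3]
  have hinj : Function.Injective f := by
    refine Function.Injective.sumElim ?_ ?_ ?_
    · intro i j hij
      fin_cases i <;> fin_cases j <;> simp_all [Ne.symm n02, Ne.symm n04, Ne.symm n24]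
    · intro i j hij
      fin_cases i <;> fin_cases j <;> simp_all [Ne.symm n13, Ne.symm n15, Ne.symm n35]
    · intro i j
      fin_cases i <;> fin_cases j <;>
        simp [e0.ne, e1.ne', e2.ne, e3.ne', e4.ne, e5.ne', n03, n25, Ne.symm n14]
  let F : Fin 3 ⊕ Fin 3 ≃ V := Equiv.ofBijective f
    ((Fintype.bijective_iff_injective_and_card f).2 ⟨hinj, by simp [hcard]⟩)
  -- Partial products of the signs along `v0 v5 v4 v3 v2 v1`: these edges become positive, and the
  -- closing edge `v0 v1` receives the total product `-1`.
  let τ : Fin 3 ⊕ Fin 3 → ℤˣ := Sum.elim ![1, ε5 * ε4 * ε3 * ε2, ε5 * ε4]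
    ![ε5 * ε4 * ε3 * ε2 * ε1, ε5, ε5 * ε4 * ε3]
  let θ : V → ℤˣ := fun p => τ (F.symm p)
  have hθ : ∀ x, θ (f x) = τ x := fun x => congrArg τ (F.symm_apply_apply x)
  have t0 : θ v0 = 1 := hθ (.inl 0)
  have t2 : θ v2 = ε5 * ε4 * ε3 * ε2 := hθ (.inl 1)
  have t4 : θ v4 = ε5 * ε4 := hθ (.inl 2)
  have t1 : θ v1 = ε5 * ε4 * ε3 * ε2 * ε1 := hθ (.inr 0)
  have t5 : θ v5 = ε5 := hθ (.inr 1)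
  have t3 : θ v3 = ε5 * ε4 * ε3 := hθ (.inr 2)
  have sX : ∀ i, s (f (.inl i)) ↔ s v0 := by
    intro i
    fin_cases i
    · exact Iff.rfl
    · exact hpar e0 e1
    · exact (hpar e2 e3).trans (hpar e0 e1)
  have sY : ∀ i, s (f (.inr i)) ↔ s v1 := by
    intro i
    fin_cases i
    · exact Iff.rfl
    · exact (hpar e3 e4).trans (hpar e1 e2)
    · exact hpar e1 e2
  have hz : ∀ p q, Γ.adjMatrix p q = 0 → switchEntry Γ.adjMatrix θ p q = 0 := fun p q h => by
    unfold switchEntry; rw [h, mul_zero]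
  have b01 : switchEntry Γ.adjMatrix θ v0 v1 = -1 := by
    rw [switchEntry_of_adj a0, t0, t1, one_mul, hε]; simp
  have b05 : switchEntry Γ.adjMatrix θ v0 v5 = 1 := by
    rw [switchEntry_of_adj a5, t0, t5, one_mul, Int.units_mul_self ε5]; simp
  have b21 : switchEntry Γ.adjMatrix θ v2 v1 = 1 := by
    rw [switchEntry_of_adj a1, t2, t1, (units_mul_mul_mul _ ε1).1]; simp
  have b23 : switchEntry Γ.adjMatrix θ v2 v3 = 1 := by
    rw [switchEntry_of_adj a2, t2, t3, (units_mul_mul_mul _ ε2).2]; simp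
  have b45 : switchEntry Γ.adjMatrix θ v4 v5 = 1 := by
    rw [switchEntry_of_adj a4, t4, t5, (units_mul_mul_mul _ ε4).2]; simp
  have b43 : switchEntry Γ.adjMatrix θ v4 v3 = 1 := by
    rw [switchEntry_of_adj a3, t4, t3, (units_mul_mul_mul _ ε3).1]; simp
  refine switchingIsomorphic_extremal (by norm_num) (by norm_num) F θ
    (fun i i' => hzero _ _ ((sX i).trans (sX i').symm))
    (fun j j' => hzero _ _ ((sY j).trans (sY j').symm)) fun i j => ?_
  change switchEntry Γ.adjMatrix θ (f (.inl i)) (f (.inr j)) = _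
  fin_cases i <;> fin_cases j <;>
    simp [f, b01, b05, b21, b23, b45, b43, hz _ _ c03, hz _ _ c41, hz _ _ c25, pathBlock, offInd,
      diffInd]

theorem switchingIsomorphic_of_card_six {Γ : SignedGraph V} (hcard : Fintype.card V = 6)
    (hbip : Γ.graph.IsBipartite) (hunb : Γ.Unbalanced) (hC4 : ¬ Γ.HasNegCycleOfLength 4) :
    Γ.SwitchingIsomorphic (extremal 3 3) := by
  classical
  obtain ⟨s, hs, -⟩ := exists_bipartition hbip
  obtain ⟨c⟩ := hbip
  obtain ⟨v0, w, hw⟩ := hunb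
  -- The length is even, at least `3`, at most the order `6`, and not `4`.
  have hlen : w.length = 6 := by
    have h4 : w.length ≠ 4 := fun h => hC4 ⟨v0, w, hw, h⟩
    have h3 := hw.1.three_le_length
    have heven : Even w.length := by
      have := SimpleGraph.two_colorable_iff_forall_loop_even.1 ⟨c⟩ v0 w
      exact this
    have hle : w.length ≤ 6 := by
      have := hw.1.support_nodup.length_le_card
      simpa [hcard] using this
    obtain ⟨k, hk⟩ := heven
    omega
  obtain ⟨hcyc, hodd⟩ := hw
  obtain _ | @⟨_, v1, _, e0, w⟩ := w
  · simp at hlen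
  obtain _ | @⟨_, v2, _, e1, w⟩ := w
  · simp at hlen
  obtain _ | @⟨_, v3, _, e2, w⟩ := w
  · simp at hlen
  obtain _ | @⟨_, v4, _, e3, w⟩ := w
  · simp at hlen
  obtain _ | @⟨_, v5, _, e4, w⟩ := w
  · simp at hlen
  obtain _ | @⟨_, v6, _, e5, w⟩ := w
  · simp at hlen
  obtain _ | @⟨_, v7, _, e6, w⟩ := w
  swap
  · simp at hlen
  have hprod := Odd.neg_one_pow (α := ℝ) hodd
  simp only [SimpleGraph.Walk.edges_cons, SimpleGraph.Walk.edges_nil, List.countP_cons,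
      List.countP_nil, zero_add, pow_add, decide_eq_true_eq, neg_one_pow_ite Γ e0,
      neg_one_pow_ite Γ e1, neg_one_pow_ite Γ e2, neg_one_pow_ite Γ e3, neg_one_pow_ite Γ e4,
      neg_one_pow_ite Γ e5] at hprod
  have hnd := hcyc.support_nodup
  simp only [SimpleGraph.Walk.support_cons, SimpleGraph.Walk.support_nil, List.tail_cons,
    List.nodup_cons, List.mem_cons, List.not_mem_nil, not_or, or_false, not_false_eq_true,
    List.nodup_nil, and_true] at hnd
  obtain ⟨⟨n12, n13, n14, n15, n10⟩, ⟨n23, n24, n25, n20⟩, ⟨n34, n35, n30⟩, ⟨n45, n40⟩, n50⟩ := hnd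
  exact switchingIsomorphic_of_hexagon hcard hs hC4 hprod e0 e1 e2 e3 e4 e5 (Ne.symm n20)
    (Ne.symm n30) (Ne.symm n40) n13 n14 n15 n24 n25 n35

end Main

end SignedGraph


theorem theorem2 {V : Type*} [Fintype V] [DecidableEq V] (Γ : SignedGraph V) (n : ℕ)
    (hcard : Fintype.card V = n) (hn : 6 ≤ n) (hbip : Γ.graph.IsBipartite)
    (hunb : Γ.Unbalanced) (hC4 : ¬ Γ.HasNegCycleOfLength 4) (B : ℝ)
    (hB : B = if Even n then
        (1 / 4 : ℝ) * ((n : ℝ) - 6 + √(((n : ℝ) - 2) * ((n : ℝ) + 6)))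
      else
        √((1 / 8 : ℝ) * ((n : ℝ) ^ 2 - 4 * (n : ℝ) + 11 +
          √(((n : ℝ) ^ 2 - 4 * (n : ℝ) + 11) ^ 2 - 64 * ((n : ℝ) - 2) * ((n : ℝ) - 4))))) :
    Γ.rho ≤ B ∧
      (Γ.rho = B ↔ Γ.SwitchingIsomorphic (SignedGraph.extremal (n / 2) ((n + 1) / 2))) := by
  have hB' : B = SignedGraph.rhoBound n := hB
  rw [hB', ← SignedGraph.rho_extremal hn]
  by_cases hn7 : 7 ≤ n
  · obtain ⟨hle, heq⟩ := SignedGraph.rho_le_of_seven_le hcard hn7 hbip hunb hC4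
    rw [← SignedGraph.rho_extremal hn] at hle heq
    exact ⟨hle, heq, SignedGraph.SwitchingIsomorphic.rho_eq⟩
  · obtain rfl : n = 6 := by omega
    have hiso := SignedGraph.switchingIsomorphic_of_card_six hcard hbip hunb hC4
    exact ⟨hiso.rho_eq.le, fun _ => hiso, fun _ => hiso.rho_eq⟩
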